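/- \textbf{Setting.} The state of nature is $\theta\in\{H,L\}$ with $\Pr(\theta=H)=p\in(0,1)$. Let $S$ be a finite set of signals and let $\pi_H\neq\pi_L$ be two probability distributions on $S$ with full support. A \emph{protocol} with $m\ge 2$ memory states $M=\{1,\dots,m\}$ is a triple $\Pi=(f,g,a)$ with $f:M\times S\to\Delta(M)$ (transition function), $g\in\Delta(M)$ (initial distribution) and $a:M\to[0,1]$ (probability of taking action $H$). A memory state $i$ is \emph{absorbing} if $f(i,s)(i)=1$ for all $s\in S$. The sender knows $\theta$ and observes the current memory state; her strategy $\sigma:M\times\{H,L\}\to[0,1]$ gives the probability of stopping. The initial memory state $m_0$ is drawn from $g$. In each period $t=0,1,2,\dots$, the game ends if $m_t$ is absorbing, and otherwise it ends with probability $\sigma(m_t,\theta)$; if it does not end, a signal $s_t\sim\pi_\theta$ is drawn (independently over time given $\theta$) and $m_{t+1}$ is drawn from $f(m_t,s_t)$. If the game ends in memory state $i$, action $H$ is taken with probability $a(i)$ and action $L$ otherwise. The receiver's payoff is $1$ if the action taken equals $\theta$ and $0$ otherwise; the sender's payoff is $1$ if action $H$ is taken and $0$ otherwise; if the game never ends,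 both payoffs are $0$. Let $U^R(\Pi,\sigma)$ and $U^S(\Pi,\sigma)$ be the expected payoffs, and let $\mathrm{br}(\Pi)$ be the set of strategies $\sigma$ that maximize $U^S(\Pi,\cdot)$. A protocol is \emph{parsimonious} if it has two absorbing memory states, one in which $L$ is played with probability $1$ and one in which $H$ is played with probability $1$, and all other memory states are transient (for the Markov chain on $M$ with transition probabilities $\sum_{s}\pi_\theta(s)f(i,s)(j)$, for each $\theta$), with $L$ played with probability $1$. Let $\gamma=\dfrac{\max_{s\in S}\pi_H(s)/\pi_L(s)}{\min_{s\in S}\pi_H(s)/\pi_L(s)}$ and $\kappa=\max\left\{\dfrac{p}{1-p},\dfrac{1-p}{p}\right\}$. \textbf{Theorem.} Let $(\Pi^n)_{n\ge 1}$ be a sequence of parsimonious protocols with $m$ memory states and let $\sigma^n\in\mathrm{br}(\Pi^n)$ be such that $$\lim_{n\to\infty}U^R(\Pi^n,\sigma^n)=\sup_{\Pi}\ \sup_{\sigma\in\mathrm{br}(\Pi)}U^R(\Pi,\sigma),$$ where the supremum is over all protocols $\Pi$ with $m$ memory states. Then $\lim_{n\to\infty}U^S(\Pi^n,\sigma^n)$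 exists whenever $\gamma^{m-2}>\kappa$ or $p\ne\tfrac12$, and $$\lim_{n\to\infty}U^S(\Pi^n,\sigma^n)=\begin{cases}p+\dfrac{2p-1}{\gamma^{m-2}-1}, & \text{if }\gamma^{m-2}>\kappa,\\[0.3em] 1, & \text{if }\gamma^{m-2}\le\kappa\text{ and }p>\tfrac12,\\[0.3em] 0, & \text{if }\gamma^{m-2}\le\kappa\text{ and }p<\tfrac12.\end{cases}$$ -/

import Mathlib

open Filter Topology

namespace Persuasion

/-- The state of nature: `H` or `L`. -/
inductive Nature : Type
  | H : Nature
  | L : Nature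

/-- A signal structure on a finite set `S`: for each state of nature a probability distribution
with full support, the two distributions being different. -/
structure SignalStructure (S : Type*) [Fintype S] where
  /-- `prob θ s` is the probability of signal `s` in the state of nature `θ`. -/
  prob : Nature → S → ℝ
  prob_pos : ∀ θ s, 0 < prob θ s
  sum_prob : ∀ θ, ∑ s, prob θ s = 1
  informative : prob Nature.H ≠ prob Nature.L

/-- A protocol with `m` memory states: a stochastic automaton reading signals in `S`. -/
structure Protocol (S : Type*) (m : ℕ) where
  /-- transition function: `f i s j` is the probability of moving from `i` to `j` on signal `s` -/
  f : Fin m → S → stdSimplex ℝ (Fin m)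
  /-- initial distribution -/
  g : stdSimplex ℝ (Fin m)
  /-- action rule: `a i` is the probability of taking action `H` in memory state `i` -/
  a : Fin m → Set.Icc (0 : ℝ) 1

/-- A sender strategy: the probability of stopping, given the current memory state and the
state of nature. -/
abbrev Strategy (m : ℕ) : Type := Fin m → Nature → Set.Icc (0 : ℝ) 1

section MarkovChain

variable {M : Type*} [Fintype M]

open Classical in
/-- For a chain with transition matrix `P`: the probability, starting from `k`, of not being in
state `i` at any of the times `1, …, n`. -/
noncomputable def avoidProb (P : Matrix M M ℝ) (i : M) : ℕ → M → ℝ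
  | 0, _ => 1
  | n + 1, k => ∑ j, if j = i then 0 else P k j * avoidProb P i n j

/-- A state is transient if, starting from it, the chain has a positive probability of never
returning to it. (The probability of never returning is the limit of the nonincreasing sequence of
probabilities of not returning up to time `n`.) -/
def IsTransient (P : Matrix M M ℝ) (i : M) : Prop :=
  0 < ⨅ n : ℕ, avoidProb P i n i

end MarkovChain

section Game

variable {S : Type*} [Fintype S] {m : ℕ}

/-- The transition matrix of the Markov chain on memory states that the protocol induces in the
state of nature `θ` (when signals keep being generated). -/
def Protocol.chain (Q : Protocol S m) (D : SignalStructure S) (θ : Nature) :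
    Matrix (Fin m) (Fin m) ℝ :=
  fun i j => ∑ s, D.prob θ s * (Q.f i s).1 j

/-- A memory state is absorbing if it is not updated in response to any signal. -/
def Protocol.IsAbsorbing (Q : Protocol S m) (i : Fin m) : Prop :=
  ∀ s, (Q.f i s).1 i = 1

open Classical in
/-- The probability that the game ends in the current period, given that it has not ended before
and that the current memory state is `i`: the game ends if `i` is absorbing or the sender stops. -/
noncomputable def endsAt (Q : Protocol S m) (σ : Strategy m) (θ : Nature) (i : Fin m) : ℝ :=
  if Q.IsAbsorbing i then 1 else (σ i θ : ℝ)

/-- `alive D Q σ θ t i` is the probability, in the state of nature `θ`, that the game has not ended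
before period `t` and that the memory state in period `t` is `i`. -/
noncomputable def alive (D : SignalStructure S) (Q : Protocol S m) (σ : Strategy m) (θ : Nature) :
    ℕ → Fin m → ℝ
  | 0, i => Q.g.1 i
  | t + 1, j => ∑ i, alive D Q σ θ t i * (1 - endsAt Q σ θ i) * Q.chain D θ i j

/-- The probability, in the state of nature `θ`, that the game ends in memory state `i`. -/
noncomputable def endProb (D : SignalStructure S) (Q : Protocol S m) (σ : Strategy m) (θ : Nature)
    (i : Fin m) : ℝ :=
  ∑' t : ℕ, alive D Q σ θ t i * endsAt Q σ θ i

/-- The probability, in the state of nature `θ`, that the game ends and action `H` is taken. -/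
noncomputable def probActionH (D : SignalStructure S) (Q : Protocol S m) (σ : Strategy m)
    (θ : Nature) : ℝ :=
  ∑ i, endProb D Q σ θ i * (Q.a i : ℝ)

/-- The probability, in the state of nature `θ`, that the game ends and action `L` is taken. -/
noncomputable def probActionL (D : SignalStructure S) (Q : Protocol S m) (σ : Strategy m)
    (θ : Nature) : ℝ :=
  ∑ i, endProb D Q σ θ i * (1 - (Q.a i : ℝ))

/-- The sender's expected payoff: 1 if action `H` is taken, 0 otherwise. -/
noncomputable def senderPayoff (p : ℝ) (D : SignalStructure S) (Q : Protocol S m)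
    (σ : Strategy m) : ℝ :=
  p * probActionH D Q σ Nature.H + (1 - p) * probActionH D Q σ Nature.L

/-- The receiver's expected payoff: 1 if an action is taken and matches the state of nature,
0 otherwise. -/
noncomputable def receiverPayoff (p : ℝ) (D : SignalStructure S) (Q : Protocol S m)
    (σ : Strategy m) : ℝ :=
  p * probActionH D Q σ Nature.H + (1 - p) * probActionL D Q σ Nature.L

/-- The sender's best responses to a protocol. -/
def bestResponses (p : ℝ) (D : SignalStructure S) (Q : Protocol S m) : Set (Strategy m) :=
  {σ | ∀ σ' : Strategy m, senderPayoff p D Q σ' ≤ senderPayoff p D Q σ}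

/-- The receiver's optimal payoff with `m` memory states: the supremum, over all protocols and all
best responses of the sender, of the receiver's payoff. -/
noncomputable def optimalReceiverPayoff (p : ℝ) (D : SignalStructure S) (m : ℕ) : ℝ :=
  sSup {u : ℝ | ∃ Q : Protocol S m, ∃ σ ∈ bestResponses p D Q, u = receiverPayoff p D Q σ}

/-- A protocol is parsimonious if it has an absorbing memory state in which `L` is played, an
absorbing memory state in which `H` is played, and all other memory states are transient (in either
state of nature), with `L` played. -/
def Protocol.IsParsimonious (Q : Protocol S m) (D : SignalStructure S) : Prop :=
  ∃ lo hi : Fin m,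
    Q.IsAbsorbing lo ∧ (Q.a lo : ℝ) = 0 ∧
    Q.IsAbsorbing hi ∧ (Q.a hi : ℝ) = 1 ∧
    ∀ i, i ≠ lo → i ≠ hi → (∀ θ, IsTransient (Q.chain D θ) i) ∧ (Q.a i : ℝ) = 0

/-- The ratio of the largest to the smallest likelihood ratio of the signals. -/
noncomputable def SignalStructure.gamma (D : SignalStructure S) : ℝ :=
  (⨆ s, D.prob Nature.H s / D.prob Nature.L s) / (⨅ s, D.prob Nature.H s / D.prob Nature.L s)

/-- The skewness of the prior. -/
noncomputable def kappa (p : ℝ) : ℝ := max (p / (1 - p)) ((1 - p) / p)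

theorem sum_chain (Q : Protocol S m) (D : SignalStructure S) (θ : Nature) (i : Fin m) :
    ∑ j, Q.chain D θ i j = 1 := by
  simp only [Protocol.chain]
  rw [Finset.sum_comm]
  simp only [← Finset.mul_sum, (Q.f i _).2.2, mul_one, D.sum_prob]

theorem chain_nonneg (Q : Protocol S m) (D : SignalStructure S) (θ : Nature) (i j : Fin m) :
    0 ≤ Q.chain D θ i j :=
  Finset.sum_nonneg fun s _ => mul_nonneg (D.prob_pos θ s).le ((Q.f i s).2.1 j)

theorem endsAt_mem {R : Type*} (Q : Protocol R m) (σ : Strategy m) (θ : Nature) (i : Fin m) :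
    0 ≤ endsAt Q σ θ i ∧ endsAt Q σ θ i ≤ 1 := by
  unfold endsAt
  split_ifs
  · norm_num
  · exact (σ i θ).2

theorem alive_nonneg (D : SignalStructure S) (Q : Protocol S m) (σ : Strategy m) (θ : Nature)
    (t : ℕ) (i : Fin m) : 0 ≤ alive D Q σ θ t i := by
  induction t generalizing i with
  | zero => exact Q.g.2.1 i
  | succ t ih =>
    exact Finset.sum_nonneg fun k _ => mul_nonneg
      (mul_nonneg (ih k) (sub_nonneg.2 (endsAt_mem Q σ θ k).2)) (chain_nonneg Q D θ k i)

/-- By any period, the game has either ended or is still alive. -/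
theorem sum_ended_add_alive (D : SignalStructure S) (Q : Protocol S m) (σ : Strategy m)
    (θ : Nature) (T : ℕ) :
    ∑ t ∈ Finset.range T, ∑ i, alive D Q σ θ t i * endsAt Q σ θ i + ∑ i, alive D Q σ θ T i = 1 := by
  induction T with
  | zero => simpa [alive] using Q.g.2.2
  | succ T ih =>
    have h : ∑ j, alive D Q σ θ (T + 1) j = ∑ i, alive D Q σ θ T i * (1 - endsAt Q σ θ i) := by
      simp only [alive]
      rw [Finset.sum_comm]
      simp only [← Finset.mul_sum, sum_chain, mul_one]
    refine Eq.trans ?_ ih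
    rw [Finset.sum_range_succ, h, add_assoc, ← Finset.sum_add_distrib, add_right_inj]
    exact Finset.sum_congr rfl fun i _ => by ring

/-- The series that defines `endProb` converges. -/
theorem summable_endProb (D : SignalStructure S) (Q : Protocol S m) (σ : Strategy m) (θ : Nature)
    (i : Fin m) : Summable fun t : ℕ => alive D Q σ θ t i * endsAt Q σ θ i := by
  have h0 : ∀ t k, 0 ≤ alive D Q σ θ t k * endsAt Q σ θ k := fun t k =>
    mul_nonneg (alive_nonneg D Q σ θ t k) (endsAt_mem Q σ θ k).1
  refine summable_of_sum_range_le (c := 1) (fun t => h0 t i) fun T => ?_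
  calc ∑ t ∈ Finset.range T, alive D Q σ θ t i * endsAt Q σ θ i
      ≤ ∑ t ∈ Finset.range T, ∑ k, alive D Q σ θ t k * endsAt Q σ θ k :=
        Finset.sum_le_sum fun t _ =>
          Finset.single_le_sum (f := fun k => alive D Q σ θ t k * endsAt Q σ θ k)
            (fun k _ => h0 t k) (Finset.mem_univ i)
    _ ≤ 1 := by
        have h1 := sum_ended_add_alive D Q σ θ T
        have h2 : 0 ≤ ∑ k, alive D Q σ θ T k :=
          Finset.sum_nonneg fun k _ => alive_nonneg D Q σ θ T k
        linarith

end Game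

end Persuasion

/-! Let `x` and `y` be the probabilities of action `H` in the natures `H` and `L`, and let R =
γ^(m-2). In a parsimonious protocol `H` is taken only on absorption, so stopping early never helps
the sender: every best response gives the same `x` and `y` as never stopping. The game then ends
almost surely, and the two payoffs are p x + (1-p)(1-y) and p x + (1-p) y.

Upper constraint. The transition matrices of the two natures agree entrywise up to factors between
the extreme likelihood ratios. Replacing one row by its counterpart multiplies the odds of
absorption at `H` by at most γ (`odds_row_change`). There are m-2 transient rows, so x(1-y) ≤
R(1-x)y (`odds_le`, `Protocol.IsParsimonious.payoffs`).

Lower bound on the optimal value. Constant protocols give p and 1-p. Protocols that reset on bad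
news approach every interior point of the boundary curve of the constraint (`curve_le_optimal`). No
sharp upper bound over general protocols is needed: the given sequence obeys the constraint and
attains the value by hypothesis.

Conclusion. Put α = 1-x, β = y and c = 1/(R-1). For R > 1 the constraint reads (α+c)(β+c) ≥ c+c². If
R > κ, the AM-GM minimizer of p(α+c) + (1-p)(β+c) lies inside the unit square, and near-optimality
forces p(α+c) - (1-p)(β+c) → 0, which determines the sender's payoff although x and y were not
assumed to converge (`tendsto_sub_of_hyperbola`). If R ≤ κ and p ≠ 1/2, the loss relative to the
better constant action dominates a positive multiple of a product of deviations from it, so both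
deviations vanish (`tendsto_add_of_mul_le_sub`). -/

namespace Persuasion

/-! ### Maximum principle, Dirichlet problem, and perturbation of absorption odds -/

section Absorption

variable {M : Type*} [Fintype M]

/-- The maximum principle for the chain with transition matrix `P` and boundary `B`: a function
that is subharmonic off `B` and nonpositive on `B` is nonpositive. -/
def Absorbs (P : Matrix M M ℝ) (B : Set M) : Prop :=
  ∀ f : M → ℝ, (∀ j ∈ B, f j ≤ 0) → (∀ j ∉ B, f j ≤ ∑ k, P j k * f k) → ∀ j, f j ≤ 0

theorem Absorbs.nonneg {P : Matrix M M ℝ} {B : Set M} (h : Absorbs P B) {f : M → ℝ}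
    (hB : ∀ j ∈ B, 0 ≤ f j) (hf : ∀ j ∉ B, ∑ k, P j k * f k ≤ f j) (j : M) : 0 ≤ f j := by
  have := h (fun j => - f j) (fun j hj => neg_nonpos.2 (hB j hj))
    (fun j hj => by simpa using hf j hj) j
  linarith

theorem Absorbs.eq_zero {P : Matrix M M ℝ} {B : Set M} (h : Absorbs P B) {f : M → ℝ}
    (hB : ∀ j ∈ B, f j = 0) (hf : ∀ j ∉ B, f j = ∑ k, P j k * f k) (j : M) : f j = 0 :=
  le_antisymm (h f (fun j hj => (hB j hj).le) (fun j hj => (hf j hj).le) j)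
    (h.nonneg (fun j hj => (hB j hj).ge) (fun j hj => (hf j hj).ge) j)

/-- The Dirichlet problem (with a source term) is solvable. -/
theorem Absorbs.exists_solution {P : Matrix M M ℝ} {B : Set M} (h : Absorbs P B) (b : M → ℝ) :
    ∃ f : M → ℝ, (∀ j ∈ B, f j = b j) ∧ ∀ j ∉ B, f j = b j + ∑ k, P j k * f k := by
  classical
  -- `T` is the identity minus `P` with the rows in `B` deleted. The maximum principle makes it
  -- injective, hence surjective in finite dimension; `b` serves as boundary value on `B` and as
  -- source off `B`.
  let T : (M → ℝ) →ₗ[ℝ] (M → ℝ) :=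
    { toFun := fun f j => f j - if j ∈ B then 0 else ∑ k, P j k * f k
      map_add' := fun f f' => by
        ext j
        by_cases hj : j ∈ B
        · simp [hj]
        · simp only [hj, if_false, Pi.add_apply, mul_add, Finset.sum_add_distrib]
          ring
      map_smul' := fun r f => by
        ext j
        by_cases hj : j ∈ B
        · simp [hj]
        · simp only [hj, if_false, Pi.smul_apply, smul_eq_mul, RingHom.id_apply, mul_sub,
            Finset.mul_sum]
          congr 1
          exact Finset.sum_congr rfl fun k _ => by ring }
  have hT : ∀ f j, T f j = f j - if j ∈ B then 0 else ∑ k, P j k * f k := fun _ _ => rfl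
  have hinj : Function.Injective T := by
    rw [← LinearMap.ker_eq_bot, LinearMap.ker_eq_bot']
    intro f hf
    ext j
    refine h.eq_zero (fun j hj => ?_) (fun j hj => ?_) j
    · have := congrFun hf j
      simpa [hT, hj] using this
    · have := congrFun hf j
      simp only [hT, hj, if_false, Pi.zero_apply] at this
      linarith
  obtain ⟨f, hf⟩ := (LinearMap.injective_iff_surjective.1 hinj) b
  refine ⟨f, fun j hj => ?_, fun j hj => ?_⟩
  · have := congrFun hf j
    simpa [hT, hj] using this
  · have := congrFun hf j
    simp only [hT, hj, if_false] at this
    linarith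

/-- The positive part of the given function vanishes on the larger boundary, so it is subharmonic
everywhere and the principle for the smaller boundary applies to it. -/
theorem Absorbs.mono {P : Matrix M M ℝ} (hP : ∀ i j, 0 ≤ P i j) {B B' : Set M} (h : Absorbs P B)
    (hBB : B ⊆ B') : Absorbs P B' := by
  intro f hB hf j
  refine (le_max_left (f j) 0).trans (h (fun j => max (f j) 0) (fun j hj => ?_) (fun j _ => ?_) j)
  · exact max_le (hB j (hBB hj)) le_rfl
  · have h0 : 0 ≤ ∑ k, P j k * max (f k) 0 :=
      Finset.sum_nonneg fun k _ => mul_nonneg (hP j k) (le_max_right _ _)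
    by_cases hj' : j ∈ B'
    · exact max_le ((hB j hj').trans h0) h0
    · exact max_le ((hf j hj').trans (Finset.sum_le_sum fun k _ =>
        mul_le_mul_of_nonneg_left (le_max_left _ _) (hP j k))) h0

/-- A chain absorbs if no nonempty set of states off the boundary is closed. -/
theorem absorbs_of_forall_closed {P : Matrix M M ℝ} (hP : ∀ i j, 0 ≤ P i j)
    (hP1 : ∀ i, ∑ j, P i j = 1) {B : Set M}
    (h : ∀ C : Set M, C.Nonempty → (∀ i ∈ C, i ∉ B) → ∃ i ∈ C, ∃ j ∉ C, P i j ≠ 0) :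
    Absorbs P B := by
  intro f hB hf
  by_contra! hne
  obtain ⟨j₀, hj₀⟩ := hne
  have : Nonempty M := ⟨j₀⟩
  obtain ⟨i₀, hi₀⟩ := Finite.exists_max f
  have hpos : 0 < f i₀ := hj₀.trans_le (hi₀ j₀)
  have hCB : ∀ i ∈ {i | f i = f i₀}, i ∉ B := fun i hi hiB => by
    have := hB i hiB
    rw [Set.mem_ofPred_eq] at hi
    linarith
  -- A positive maximum is attained off `B` only; an exit from the set of maximizers would make the
  -- average at `i` strictly smaller than the maximum.
  obtain ⟨i, hi, j, hj, hij⟩ := h {i | f i = f i₀} ⟨i₀, rfl⟩ hCB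
  have h1 := hf i (hCB i hi)
  have h2 : ∑ k, P i k * f k < ∑ k, P i k * f i₀ :=
    Finset.sum_lt_sum (fun k _ => mul_le_mul_of_nonneg_left (hi₀ k) (hP i k))
      ⟨j, Finset.mem_univ j, mul_lt_mul_of_pos_left (lt_of_le_of_ne (hi₀ j) hj)
        (lt_of_le_of_ne (hP i j) (Ne.symm hij))⟩
  rw [← Finset.sum_mul, hP1, one_mul] at h2
  rw [Set.mem_ofPred_eq] at hi
  linarith

/-- The indicator of a closed set off `B` would be subharmonic and zero on `B`, against the maximum
principle. With the converse above, this makes absorption a property of the support of `P`. -/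
theorem Absorbs.exists_exit {P : Matrix M M ℝ} (hP : ∀ i j, 0 ≤ P i j)
    (hP1 : ∀ i, ∑ j, P i j = 1) {B : Set M} (h : Absorbs P B) {C : Set M} (hC : C.Nonempty)
    (hCB : ∀ i ∈ C, i ∉ B) : ∃ i ∈ C, ∃ j ∉ C, P i j ≠ 0 := by
  classical
  by_contra! hcl
  obtain ⟨i, hi⟩ := hC
  have := h (fun j => if j ∈ C then 1 else 0) (fun j hj => ?_) (fun j _ => ?_) i
  · simp only [hi, if_true] at this
    linarith
  · have : j ∉ C := fun hjC => hCB j hjC hj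
    simp [this]
  · by_cases hj : j ∈ C
    · simp only [hj, if_true]
      refine (hP1 j).symm.trans_le (Finset.sum_congr rfl fun k _ => ?_).le
      by_cases hk : k ∈ C
      · simp [hk]
      · simp [hk, hcl j hj k hk]
    · simp only [hj, if_false]
      exact Finset.sum_nonneg fun k _ => mul_nonneg (hP j k) (by split_ifs <;> norm_num)

/-- Absorption depends only on which transitions are possible. -/
theorem Absorbs.of_support {P P' : Matrix M M ℝ} (hP : ∀ i j, 0 ≤ P i j)
    (hP1 : ∀ i, ∑ j, P i j = 1) (hP' : ∀ i j, 0 ≤ P' i j) (hP1' : ∀ i, ∑ j, P' i j = 1)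
    {B : Set M} (h : Absorbs P B) (hs : ∀ i j, P i j ≠ 0 → P' i j ≠ 0) : Absorbs P' B :=
  absorbs_of_forall_closed hP' hP1' fun _ hC hCB =>
    let ⟨i, hi, j, hj, hij⟩ := h.exists_exit hP hP1 hC hCB
    ⟨i, hi, j, hj, hs i j hij⟩

/-- `h` is harmonic off `B` with values in the unit interval on `B`. -/
structure HarmonicOff (P : Matrix M M ℝ) (B : Set M) (h : M → ℝ) : Prop where
  eq : ∀ j ∉ B, h j = ∑ k, P j k * h k
  nonneg : ∀ j ∈ B, 0 ≤ h j
  le_one : ∀ j ∈ B, h j ≤ 1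

theorem HarmonicOff.nonneg_all {P : Matrix M M ℝ} {B : Set M} {h : M → ℝ}
    (hh : HarmonicOff P B h) (hA : Absorbs P B) (j : M) : 0 ≤ h j :=
  hA.nonneg hh.nonneg (fun j hj => (hh.eq j hj).ge) j

theorem HarmonicOff.one_sub {P : Matrix M M ℝ} (hP1 : ∀ i, ∑ j, P i j = 1) {B : Set M} {h : M → ℝ}
    (hh : HarmonicOff P B h) : HarmonicOff P B (fun j => 1 - h j) where
  eq j hj := by simp only [mul_sub, Finset.sum_sub_distrib, mul_one, hP1, ← hh.eq j hj]
  nonneg j hj := sub_nonneg.2 (hh.le_one j hj)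
  le_one j hj := by linarith [hh.nonneg j hj]

theorem HarmonicOff.le_one_all {P : Matrix M M ℝ} (hP1 : ∀ i, ∑ j, P i j = 1) {B : Set M}
    {h : M → ℝ} (hh : HarmonicOff P B h) (hA : Absorbs P B) (j : M) : h j ≤ 1 :=
  sub_nonneg.1 ((hh.one_sub hP1).nonneg_all hA j)

/-- The odds of a mixture of `q = a + v x` against `b + v (1 - x)` change by no more than the
odds of `x`. -/
theorem odds_mixture {x x' a b v G : ℝ} (hG : 1 ≤ G) (ha : 0 ≤ a) (hb : 0 ≤ b) (hv : 0 ≤ v)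
    (hx0 : 0 ≤ x) (hx1 : x ≤ 1) (hx0' : 0 ≤ x') (hx1' : x' ≤ 1)
    (hodds : x' * (1 - x) ≤ G * ((1 - x') * x)) :
    (a + v * x') * (b + v * (1 - x)) ≤ G * ((b + v * (1 - x')) * (a + v * x)) := by
  have key : ∀ y z : ℝ, 0 ≤ y → y ≤ z → y ≤ G * z := fun y z hy hyz => by nlinarith
  rcases le_or_gt x' x with hle | hlt
  · refine key _ _ (mul_nonneg (by positivity) (add_nonneg hb (mul_nonneg hv (by linarith)))) ?_
    have h1 : v * x' ≤ v * x := mul_le_mul_of_nonneg_left hle hv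
    have h2 : v * (1 - x) ≤ v * (1 - x') := mul_le_mul_of_nonneg_left (by linarith) hv
    rw [mul_comm (b + _)]
    exact mul_le_mul (by linarith) (by linarith)
      (add_nonneg hb (mul_nonneg hv (by linarith))) (by positivity)
  -- When x < x', the odds bound controls numerator and denominator separately; these two bounds
  -- handle the cross terms of the expanded product.
  · have h1 : 1 - x ≤ G * (1 - x') := by
      have : x' * (1 - x) ≤ x' * (G * (1 - x')) := by
        calc x' * (1 - x) ≤ G * ((1 - x') * x) := hodds
          _ ≤ G * ((1 - x') * x') := by gcongr
          _ = _ := by ring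
      exact le_of_mul_le_mul_left this (by linarith)
    have h2 : x' ≤ G * x := by
      have : (1 - x) * x' ≤ (1 - x) * (G * x) := by
        calc (1 - x) * x' ≤ G * ((1 - x') * x) := by linarith
          _ ≤ G * ((1 - x) * x) := by gcongr
          _ = _ := by ring
      exact le_of_mul_le_mul_left this (by linarith)
    have e1 : a * b ≤ G * (a * b) := key _ _ (by positivity) le_rfl
    have e2 : a * v * (1 - x) ≤ a * v * (G * (1 - x')) :=
      mul_le_mul_of_nonneg_left h1 (by positivity)
    have e3 : b * v * x' ≤ b * v * (G * x) := mul_le_mul_of_nonneg_left h2 (by positivity)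
    have e4 : v * v * (x' * (1 - x)) ≤ v * v * (G * ((1 - x') * x)) :=
      mul_le_mul_of_nonneg_left hodds (by positivity)
    linarith

/-- Changing one row of the transition matrix by factors in `[c, C]` changes the odds of
absorption by a factor of at most `C / c`. -/
theorem odds_row_change {P P' : Matrix M M ℝ} (hP : ∀ i j, 0 ≤ P i j)
    (hP1 : ∀ i, ∑ j, P i j = 1) (hP1' : ∀ i, ∑ j, P' i j = 1) {B : Set M}
    (hA : Absorbs P B) (hA' : Absorbs P' B) {i : M} (hi : i ∉ B)
    (hrow : ∀ j, j ≠ i → P' j = P j) {c C : ℝ} (hc : 0 < c)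
    (hcP : ∀ k, c * P i k ≤ P' i k) (hCP : ∀ k, P' i k ≤ C * P i k)
    {h h' : M → ℝ} (hh : HarmonicOff P B h) (hh' : HarmonicOff P' B h')
    (hB : ∀ j ∈ B, h j = h' j) {g : M → ℝ} (hg : ∀ j, 0 ≤ g j) (hg1 : ∑ j, g j = 1) :
    (∑ j, g j * h' j) * (1 - ∑ j, g j * h j) ≤
      C / c * ((1 - ∑ j, g j * h' j) * ∑ j, g j * h j) := by
  classical
  have hAi : Absorbs P (insert i B) := hA.mono hP (Set.subset_insert i B)
  -- `u j` is the probability of reaching `i` before `B` from `j`. It does not involve row `i`, so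
  -- it serves both chains.
  obtain ⟨u, hu1, hu2⟩ := hAi.exists_solution (Pi.single i 1)
  have hui : u i = 1 := by simpa using hu1 i (Set.mem_insert i B)
  have huB : ∀ j ∈ B, u j = 0 := fun j hj => by
    have hji : j ≠ i := fun e => hi (e ▸ hj)
    simpa [hji] using hu1 j (Set.mem_insert_of_mem i hj)
  have huh : ∀ j ∉ insert i B, u j = ∑ k, P j k * u k := fun j hj => by
    have hji : j ≠ i := fun e => hj (e ▸ Set.mem_insert i B)
    simpa [hji] using hu2 j hj
  have hu0 : ∀ j, 0 ≤ u j := hAi.nonneg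
    (fun j hj => by
      rcases hj with rfl | hj
      · rw [hui]; norm_num
      · rw [huB j hj]) (fun j hj => (huh j hj).ge)
  have hnotB : ∀ j, j ∉ insert i B → j ≠ i ∧ j ∉ B := fun j hj =>
    ⟨fun e => hj (e ▸ Set.mem_insert i B), fun e => hj (Set.mem_insert_of_mem i e)⟩
  set x := h i with hx
  set x' := h' i with hx'
  -- Off `i` the two chains coincide, so the solutions differ only through their value at `i`,
  -- weighted by the chance of getting there.
  have hdiff : ∀ j, h' j = h j + (x' - x) * u j := by
    have := hAi.eq_zero (f := fun j => h' j - h j - (x' - x) * u j) (fun j hj => ?_)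
      (fun j hj => ?_)
    · intro j
      linarith [this j]
    · rcases hj with rfl | hj
      · simp [hui, hx, hx']
      · simp [huB j hj, hB j hj]
    · obtain ⟨hji, hjB⟩ := hnotB j hj
      have e1 := hh.eq j hjB
      have e2 := hh'.eq j hjB
      rw [hrow j hji] at e2
      rw [e1, e2, huh j hj, Finset.mul_sum, ← Finset.sum_sub_distrib, ← Finset.sum_sub_distrib]
      exact Finset.sum_congr rfl fun k _ => by ring
  -- The difference is the part of `f` earned on `B` without ever visiting `i`. It is used for `h`
  -- and for `1 - h`.
  have aux : ∀ f : M → ℝ, HarmonicOff P B f → ∀ j, 0 ≤ f j - f i * u j := by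
    intro f hf
    refine hAi.nonneg (fun j hj => ?_) (fun j hj => ?_)
    · rcases hj with rfl | hj
      · simp [hui]
      · simpa [huB j hj] using hf.nonneg j hj
    · obtain ⟨hji, hjB⟩ := hnotB j hj
      rw [hf.eq j hjB, huh j hj, Finset.mul_sum, ← Finset.sum_sub_distrib]
      exact (Finset.sum_congr rfl fun k _ => by ring).le
  have hn := aux h hh
  have hd := aux _ (hh.one_sub hP1)
  simp only [← hx] at hn hd
  have hx0 : 0 ≤ x := hh.nonneg_all hA i
  have hx1 : x ≤ 1 := hh.le_one_all hP1 hA i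
  have hx0' : 0 ≤ x' := hh'.nonneg_all hA' i
  have hx1' : x' ≤ 1 := hh'.le_one_all hP1' hA' i
  -- escape probabilities from `i`
  have hs : 0 < 1 - ∑ k, P i k * u k := by
    by_contra! hle
    have := hA u (fun j hj => (huB j hj).le) (fun j hj => ?_) i
    · rw [hui] at this; linarith
    · by_cases hji : j = i
      · subst hji; rw [hui]; linarith
      · exact (huh j (fun e => e.elim hji hj)).le
  have hi1 : x = ∑ k, P i k * h k := hh.eq i hi
  have hi2 : x' = ∑ k, P' i k * h' k := hh'.eq i hi
  -- Renewal at `i`: x is the chance of escaping to `H` divided by the chance of escaping at all.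
  -- Hence the odds of x are a ratio of two sums that are linear in row `i`, with nonnegative
  -- weights.
  have hN : ∑ k, P i k * (h k - x * u k) = x * (1 - ∑ k, P i k * u k) := by
    have : ∑ k, P i k * (h k - x * u k) = ∑ k, P i k * h k - x * ∑ k, P i k * u k := by
      rw [Finset.mul_sum, ← Finset.sum_sub_distrib]
      exact Finset.sum_congr rfl fun k _ => by ring
    rw [this, ← hi1]; ring
  have hN' : ∑ k, P' i k * (h k - x * u k) = x' * (1 - ∑ k, P' i k * u k) := by
    have : ∑ k, P' i k * (h k - x * u k) = ∑ k, P' i k * h' k - x' * ∑ k, P' i k * u k := by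
      rw [Finset.mul_sum, ← Finset.sum_sub_distrib]
      exact Finset.sum_congr rfl fun k _ => by rw [hdiff k]; ring
    rw [this, ← hi2]; ring
  have hD : ∀ R : Matrix M M ℝ, (∀ i, ∑ j, R i j = 1) →
      ∑ k, R i k * (1 - h k - (1 - x) * u k) =
      (1 - ∑ k, R i k * u k) - ∑ k, R i k * (h k - x * u k) := by
    intro R hR
    trans ∑ k, R i k - ∑ k, R i k * u k - ∑ k, R i k * (h k - x * u k)
    · rw [← Finset.sum_sub_distrib, ← Finset.sum_sub_distrib]
      exact Finset.sum_congr rfl fun k _ => by ring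
    · rw [hR i]
  have hD1 := hD P hP1
  have hD2 := hD P' hP1'
  rw [hN] at hD1
  rw [hN'] at hD2
  have hCN : ∑ k, P' i k * (h k - x * u k) ≤ C * ∑ k, P i k * (h k - x * u k) := by
    rw [Finset.mul_sum]
    exact Finset.sum_le_sum fun k _ => by
      rw [← mul_assoc]; exact mul_le_mul_of_nonneg_right (hCP k) (hn k)
  have hcD : c * ∑ k, P i k * (1 - h k - (1 - x) * u k) ≤
      ∑ k, P' i k * (1 - h k - (1 - x) * u k) := by
    rw [Finset.mul_sum]
    exact Finset.sum_le_sum fun k _ => by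
      rw [← mul_assoc]; exact mul_le_mul_of_nonneg_right (hcP k) (hd k)
  have hcN : c * ∑ k, P i k * (h k - x * u k) ≤ ∑ k, P' i k * (h k - x * u k) := by
    rw [Finset.mul_sum]
    exact Finset.sum_le_sum fun k _ => by
      rw [← mul_assoc]; exact mul_le_mul_of_nonneg_right (hcP k) (hn k)
  rw [hN, hN'] at hCN hcN
  rw [hD1, hD2] at hcD
  set s := 1 - ∑ k, P i k * u k
  set s' := 1 - ∑ k, P' i k * u k
  -- Adding `hcN` and `hcD` gives c s ≤ s'.
  have hs' : 0 < s' := by nlinarith [mul_pos hc hs]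
  have hcC : c ≤ C := by
    have h1 := Finset.sum_le_sum fun k (_ : k ∈ Finset.univ) => (hcP k).trans (hCP k)
    rw [← Finset.mul_sum, ← Finset.mul_sum, hP1] at h1
    linarith
  have hodds : x' * (1 - x) ≤ C / c * ((1 - x') * x) := by
    rw [div_mul_eq_mul_div, le_div_iff₀ hc]
    have h1 : x' * s' * (c * ((1 - x) * s)) ≤ C * (x * s) * ((1 - x') * s') :=
      mul_le_mul hCN (by linarith) (mul_nonneg hc.le (mul_nonneg (by linarith) hs.le))
        ((mul_nonneg hx0' hs'.le).trans hCN)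
    refine le_of_mul_le_mul_right (a := s * s') ?_ (mul_pos hs hs')
    linarith
  have hq' : ∑ j, g j * h' j = ∑ j, g j * (h j - x * u j) + (∑ j, g j * u j) * x' := by
    rw [Finset.sum_mul, ← Finset.sum_add_distrib]
    exact Finset.sum_congr rfl fun k _ => by rw [hdiff k]; ring
  have hq : ∑ j, g j * h j = ∑ j, g j * (h j - x * u j) + (∑ j, g j * u j) * x := by
    rw [Finset.sum_mul, ← Finset.sum_add_distrib]
    exact Finset.sum_congr rfl fun k _ => by ring
  have hb : ∑ j, g j * (1 - h j - (1 - x) * u j) =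
      1 - ∑ j, g j * (h j - x * u j) - ∑ j, g j * u j := by
    trans ∑ j, g j - ∑ j, g j * (h j - x * u j) - ∑ j, g j * u j
    · rw [← Finset.sum_sub_distrib, ← Finset.sum_sub_distrib]
      exact Finset.sum_congr rfl fun k _ => by ring
    · rw [hg1]
  have := odds_mixture (G := C / c) (a := ∑ j, g j * (h j - x * u j))
    (b := ∑ j, g j * (1 - h j - (1 - x) * u j)) (v := ∑ j, g j * u j)
    ((one_le_div hc).2 hcC) (Finset.sum_nonneg fun j _ => mul_nonneg (hg j) (hn j))
    (Finset.sum_nonneg fun j _ => mul_nonneg (hg j) (hd j))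
    (Finset.sum_nonneg fun j _ => mul_nonneg (hg j) (hu0 j)) hx0 hx1 hx0' hx1' hodds
  rw [hb] at this
  rw [hq, hq']
  refine le_of_eq_of_le ?_ (this.trans (le_of_eq ?_)) <;> ring

/-- Odds ratios multiply. The cross-multiplied form allows probabilities 0 and 1; an intermediate y
of 0 or 1 forces x = 0 or z = 1 respectively. -/
theorem odds_trans {x y z G G' : ℝ} (hG : 0 ≤ G) (hG' : 0 ≤ G') (hx0 : 0 ≤ x) (hx1 : x ≤ 1)
    (hy0 : 0 ≤ y) (hy1 : y ≤ 1) (hz0 : 0 ≤ z) (hz1 : z ≤ 1)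
    (hxy : x * (1 - y) ≤ G * ((1 - x) * y)) (hyz : y * (1 - z) ≤ G' * ((1 - y) * z)) :
    x * (1 - z) ≤ G * G' * ((1 - x) * z) := by
  have hr : 0 ≤ G * G' * ((1 - x) * z) :=
    mul_nonneg (mul_nonneg hG hG') (mul_nonneg (by linarith) hz0)
  rcases eq_or_lt_of_le hy0 with rfl | hy0
  · have : x = 0 := le_antisymm (by linarith) hx0
    rw [this, zero_mul]
    exact this ▸ hr
  rcases eq_or_lt_of_le hy1 with rfl | hy1
  · have : z = 1 := le_antisymm hz1 (by linarith)
    rw [this] at hr ⊢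
    simpa using hr
  refine le_of_mul_le_mul_right (a := y * (1 - y)) ?_ (mul_pos hy0 (by linarith))
  calc x * (1 - z) * (y * (1 - y)) = x * (1 - y) * (y * (1 - z)) := by ring
    _ ≤ G * ((1 - x) * y) * (G' * ((1 - y) * z)) :=
        mul_le_mul hxy hyz (mul_nonneg hy0.le (by linarith))
          (mul_nonneg hG (mul_nonneg (by linarith) hy0.le))
    _ = _ := by ring

/-- If all entries of `P'` and `P` are within factors `[c, C]`, then the odds of absorption
change by at most `C / c` for every state off the boundary. -/
theorem odds_le {P P' : Matrix M M ℝ} (hP : ∀ i j, 0 ≤ P i j)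
    (hP1 : ∀ i, ∑ j, P i j = 1) (hP1' : ∀ i, ∑ j, P' i j = 1) {B : Set M}
    (hA : Absorbs P B) {c C : ℝ} (hc : 0 < c)
    (hcP : ∀ i k, c * P i k ≤ P' i k) (hCP : ∀ i k, P' i k ≤ C * P i k)
    {h h' : M → ℝ} (hh : HarmonicOff P B h) (hh' : HarmonicOff P' B h')
    (hB : ∀ j ∈ B, h j = h' j) {g : M → ℝ} (hg : ∀ j, 0 ≤ g j) (hg1 : ∑ j, g j = 1)
    (F : Finset M) (hF : ∀ i, i ∈ F ↔ i ∉ B) :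
    (∑ j, g j * h' j) * (1 - ∑ j, g j * h j) ≤
      (C / c) ^ F.card * ((1 - ∑ j, g j * h' j) * ∑ j, g j * h j) := by
  classical
  -- Rows in `A` are already replaced. Induction on `A` changes one row at a time; rows in `B` need
  -- no replacement, since harmonicity is required only off `B`.
  let mix : Finset M → Matrix M M ℝ := fun A i j => if i ∈ A then P' i j else P i j
  have hmix : ∀ A i j, mix A i j = if i ∈ A then P' i j else P i j := fun _ _ _ => rfl
  have hP' : ∀ i j, 0 ≤ P' i j := fun i j => (mul_nonneg hc.le (hP i j)).trans (hcP i j)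
  have hm0 : ∀ A i j, 0 ≤ mix A i j := fun A i j => by
    rw [hmix]; split_ifs <;> [exact hP' i j; exact hP i j]
  have hm1 : ∀ A i, ∑ j, mix A i j = 1 := fun A i => by
    simp only [hmix]; split_ifs <;> [exact hP1' i; exact hP1 i]
  have hmA : ∀ A, Absorbs (mix A) B := fun A => by
    refine hA.of_support hP hP1 (hm0 A) (hm1 A) fun i j hij => ?_
    rw [hmix]
    split_ifs
    · have : 0 < P i j := lt_of_le_of_ne (hP i j) (Ne.symm hij)
      exact ((mul_pos hc this).trans_le (hcP i j)).ne'
    · exact hij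
  have hG : 0 ≤ C / c := by
    by_cases hne : Nonempty M
    · obtain ⟨i⟩ := hne
      have h1 := Finset.sum_le_sum fun k (_ : k ∈ Finset.univ) => (hcP i k).trans (hCP i k)
      rw [← Finset.mul_sum, ← Finset.mul_sum, hP1] at h1
      exact div_nonneg (by linarith) hc.le
    · have : ∑ j, g j = 0 := by
        have := not_nonempty_iff.1 hne
        simp
      linarith
  have hgm : ∀ (R : Matrix M M ℝ) (f : M → ℝ), (∀ i, ∑ j, R i j = 1) → Absorbs R B →
      HarmonicOff R B f → 0 ≤ ∑ j, g j * f j ∧ ∑ j, g j * f j ≤ 1 := fun R f hR hRA hf =>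
    ⟨Finset.sum_nonneg fun j _ => mul_nonneg (hg j) (hf.nonneg_all hRA j), by
      rw [← hg1]
      exact Finset.sum_le_sum fun j _ =>
        mul_le_of_le_one_right (hg j) (hf.le_one_all hR hRA j)⟩
  have hq := hgm P h hP1 hA hh
  have claim : ∀ A : Finset M, A ⊆ F → ∀ f : M → ℝ, HarmonicOff (mix A) B f →
      (∀ j ∈ B, h j = f j) →
      (∑ j, g j * f j) * (1 - ∑ j, g j * h j) ≤
        (C / c) ^ A.card * ((1 - ∑ j, g j * f j) * ∑ j, g j * h j) := by
    intro A
    induction A using Finset.induction_on with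
    | empty =>
      intro _ f hf hfB
      have : ∀ j, h j - f j = 0 := hA.eq_zero (fun j hj => by simp [hfB j hj]) fun j hj => by
        have e : mix ∅ = P := by ext i j; simp [hmix]
        have := hf.eq j hj
        rw [e] at this
        rw [this, hh.eq j hj, ← Finset.sum_sub_distrib]
        exact Finset.sum_congr rfl fun k _ => by ring
      have e : f = h := by ext j; linarith [this j]
      rw [e]
      simp only [Finset.card_empty, pow_zero, one_mul]
      exact (mul_comm _ _).le
    | insert i A hiA ih =>
      intro hsub f hf hfB
      have hiB : i ∉ B := (hF i).1 (hsub (Finset.mem_insert_self i A))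
      obtain ⟨f₀, hf₀B, hf₀⟩ := (hmA A).exists_solution (fun j => if j ∈ B then h j else 0)
      have hf₀B' : ∀ j ∈ B, f₀ j = h j := fun j hj => by simpa [hj] using hf₀B j hj
      have hf₀h : HarmonicOff (mix A) B f₀ :=
        ⟨fun j hj => by simpa [hj] using hf₀ j hj, fun j hj => by
          rw [hf₀B' j hj]; exact hh.nonneg j hj, fun j hj => by
          rw [hf₀B' j hj]; exact hh.le_one j hj⟩
      have h1 := ih ((Finset.subset_insert i A).trans hsub) f₀ hf₀h
        (fun j hj => (hf₀B' j hj).symm)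
      have h2 := odds_row_change (hm0 A) (hm1 A) (hm1 (insert i A)) (hmA A) (hmA (insert i A)) hiB
        (fun j hj => by ext k; simp [hmix, hj]) hc
        (fun k => by simpa [hmix, hiA] using hcP i k)
        (fun k => by simpa [hmix, hiA] using hCP i k) hf₀h hf
        (fun j hj => by rw [hf₀B' j hj, hfB j hj]) hg hg1
      have q0 := hgm _ f₀ (hm1 A) (hmA A) hf₀h
      have q1 := hgm _ f (hm1 _) (hmA _) hf
      rw [Finset.card_insert_of_notMem hiA, pow_succ']
      exact odds_trans hG (pow_nonneg hG _) q1.1 q1.2 q0.1 q0.2 hq.1 hq.2 h2 h1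
  refine claim F subset_rfl h' ⟨fun j hj => ?_, hh'.nonneg, hh'.le_one⟩ hB
  rw [hh'.eq j hj]
  simp only [hmix, (hF j).2 hj, if_true]

end Absorption

/-! ### Transient states and absorption -/

section Transience

variable {M : Type*} [Fintype M]

theorem avoidProb_nonneg {P : Matrix M M ℝ} (hP : ∀ i j, 0 ≤ P i j) (i : M) (n : ℕ) (k : M) :
    0 ≤ avoidProb P i n k := by
  induction n generalizing k with
  | zero => simp [avoidProb]
  | succ n ih =>
    refine Finset.sum_nonneg fun j _ => ?_
    split_ifs
    · exact le_rfl
    · exact mul_nonneg (hP k j) (ih j)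

open Classical in
/-- Last exit decomposition: by time `N`, the chain has either visited `i` for a last time or
never visited it. -/
theorem sum_pow_mul_avoidProb [DecidableEq M] {P : Matrix M M ℝ} (hP1 : ∀ i, ∑ j, P i j = 1)
    (i : M) (N : ℕ) (k : M) :
    ∑ t ∈ Finset.range (N + 1), (P ^ t) k i * avoidProb P i (N - t) i =
      1 - if k = i then 0 else avoidProb P i N k := by
  -- `avoidProb` ignores time 0, so a chain started at `i` counts as having visited `i`; the
  -- conditional in the statement corrects for this. The induction conditions on the first step.
  induction N generalizing k with
  | zero =>
    by_cases hk : k = i <;> simp [avoidProb, hk]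
  | succ N ih =>
    rw [Finset.sum_range_succ']
    have h1 : ∑ t ∈ Finset.range (N + 1), (P ^ (t + 1)) k i * avoidProb P i (N + 1 - (t + 1)) i =
        1 - avoidProb P i (N + 1) k := by
      calc _ = ∑ t ∈ Finset.range (N + 1), ∑ j, P k j * ((P ^ t) j i * avoidProb P i (N - t) i) := by
            refine Finset.sum_congr rfl fun t _ => ?_
            rw [pow_succ', Matrix.mul_apply, Finset.sum_mul, Nat.add_sub_add_right]
            exact Finset.sum_congr rfl fun j _ => by ring
        _ = ∑ j, P k j * (1 - if j = i then 0 else avoidProb P i N j) := by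
            rw [Finset.sum_comm]
            simp only [← Finset.mul_sum, ih]
        _ = 1 - avoidProb P i (N + 1) k := by
            simp only [mul_sub, mul_one, Finset.sum_sub_distrib, hP1, avoidProb, mul_ite, mul_zero]
            congr!
    rw [h1]
    by_cases hk : k = i
    · subst hk; simp
    · simp [hk]

/-- Each visit is the last with probability at least e > 0, so last-exit decomposition bounds the
expected number of visits by 1/e; a summable sequence tends to zero. -/
theorem IsTransient.tendsto_pow [DecidableEq M] {P : Matrix M M ℝ} (hP : ∀ i j, 0 ≤ P i j)
    (hP1 : ∀ i, ∑ j, P i j = 1) {i : M} (hi : IsTransient P i) (k : M) :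
    Tendsto (fun t : ℕ => (P ^ t) k i) atTop (𝓝 0) := by
  have hpow : ∀ t a b, 0 ≤ (P ^ t) a b := fun t => by
    induction t with
    | zero => intro a b; rw [pow_zero, Matrix.one_apply]; split_ifs <;> norm_num
    | succ t ih =>
      intro a b
      rw [pow_succ, Matrix.mul_apply]
      exact Finset.sum_nonneg fun j _ => mul_nonneg (ih a j) (hP j b)
  set e := ⨅ n : ℕ, avoidProb P i n i with he
  have hpos : 0 < e := hi
  have hle : ∀ n, e ≤ avoidProb P i n i := fun n =>
    ciInf_le ⟨0, by rintro _ ⟨n, rfl⟩; exact avoidProb_nonneg hP i n i⟩ n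
  refine (summable_of_sum_range_le (c := 1 / e) (fun t => hpow t k i)
    fun T => ?_).tendsto_atTop_zero
  rw [le_div_iff₀ hpos, Finset.sum_mul]
  calc ∑ t ∈ Finset.range T, (P ^ t) k i * e
      ≤ ∑ t ∈ Finset.range (T + 1), (P ^ t) k i * e :=
        Finset.sum_le_sum_of_subset_of_nonneg (Finset.range_mono (Nat.le_succ T))
          fun t _ _ => mul_nonneg (hpow t k i) hpos.le
    _ ≤ ∑ t ∈ Finset.range (T + 1), (P ^ t) k i * avoidProb P i (T - t) i :=
        Finset.sum_le_sum fun t _ => mul_le_mul_of_nonneg_left (hle _) (hpow t k i)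
    _ ≤ 1 := by
        rw [sum_pow_mul_avoidProb hP1]
        split_ifs
        · norm_num
        · linarith [avoidProb_nonneg hP i T k]

/-- A closed set off `B` would retain mass one forever, while the mass at each of its finitely many
transient states tends to zero. -/
theorem absorbs_of_isTransient {P : Matrix M M ℝ} (hP : ∀ i j, 0 ≤ P i j)
    (hP1 : ∀ i, ∑ j, P i j = 1) {B : Set M} (h : ∀ i ∉ B, IsTransient P i) : Absorbs P B := by
  classical
  refine absorbs_of_forall_closed hP hP1 fun C hC hCB => ?_
  by_contra! hcl
  obtain ⟨k, hk⟩ := hC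
  have hmass : ∀ t : ℕ, ∀ j ∉ C, (P ^ t) k j = 0 := fun t => by
    induction t with
    | zero => intro j hj; exact Matrix.one_apply_ne fun e : k = j => hj (e ▸ hk)
    | succ t ih =>
      intro j hj
      rw [pow_succ, Matrix.mul_apply]
      refine Finset.sum_eq_zero fun l _ => ?_
      by_cases hl : l ∈ C
      · rw [hcl l hl j hj, mul_zero]
      · rw [ih l hl, zero_mul]
  have hone : ∀ t : ℕ, ∑ j, (P ^ t) k j = 1 := fun t => by
    induction t with
    | zero => simp [Matrix.one_apply]
    | succ t ih =>
      simp only [pow_succ, Matrix.mul_apply]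
      rw [Finset.sum_comm]
      simp only [← Finset.mul_sum, hP1, mul_one, ih]
  have hlim : Tendsto (fun t : ℕ => ∑ j, (P ^ t) k j) atTop (𝓝 (∑ _j : M, 0)) := by
    refine tendsto_finsetSum _ fun j _ => ?_
    by_cases hj : j ∈ C
    · exact (h j (hCB j hj)).tendsto_pow hP hP1 k
    · simp only [hmass _ j hj, tendsto_const_nhds]
  simp only [hone, Finset.sum_const_zero] at hlim
  exact one_ne_zero (tendsto_nhds_unique tendsto_const_nhds hlim)

end Transience

/-! ### The sender's incentives and the payoffs as absorption probabilities -/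

section Payoffs

variable {S : Type*} [Fintype S] {m : ℕ}

/-- The strategy of never stopping. -/
def neverStop (m : ℕ) : Strategy m := fun _ _ => ⟨0, by norm_num⟩

theorem endsAt_absorbing {R : Type*} {Q : Protocol R m} {i : Fin m} (hi : Q.IsAbsorbing i)
    (σ : Strategy m) (θ : Nature) : endsAt Q σ θ i = 1 := if_pos hi

theorem endsAt_neverStop {R : Type*} {Q : Protocol R m} {i : Fin m} (hi : ¬ Q.IsAbsorbing i)
    (θ : Nature) : endsAt Q (neverStop m) θ i = 0 := if_neg hi

theorem alive_le_neverStop (D : SignalStructure S) (Q : Protocol S m) (σ : Strategy m)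
    (θ : Nature) (t : ℕ) (i : Fin m) : alive D Q σ θ t i ≤ alive D Q (neverStop m) θ t i := by
  induction t generalizing i with
  | zero => exact le_rfl
  | succ t ih =>
    refine Finset.sum_le_sum fun k _ => mul_le_mul_of_nonneg_right ?_ (chain_nonneg Q D θ k i)
    refine mul_le_mul (ih k) ?_ (sub_nonneg.2 (endsAt_mem Q σ θ k).2) (alive_nonneg D Q _ θ t k)
    by_cases hk : Q.IsAbsorbing k
    · rw [endsAt_absorbing hk, endsAt_absorbing hk]
    · rw [endsAt_neverStop hk]
      linarith [(endsAt_mem Q σ θ k).1]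

theorem endProb_nonneg (D : SignalStructure S) (Q : Protocol S m) (σ : Strategy m)
    (θ : Nature) (i : Fin m) : 0 ≤ endProb D Q σ θ i :=
  tsum_nonneg fun t => mul_nonneg (alive_nonneg D Q σ θ t i) (endsAt_mem Q σ θ i).1

theorem endProb_le_neverStop (D : SignalStructure S) {Q : Protocol S m} (σ : Strategy m)
    (θ : Nature) {i : Fin m} (hi : Q.IsAbsorbing i) :
    endProb D Q σ θ i ≤ endProb D Q (neverStop m) θ i := by
  refine (summable_endProb D Q σ θ i).tsum_le_tsum (fun t => ?_) (summable_endProb D Q _ θ i)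
  rw [endsAt_absorbing hi, endsAt_absorbing hi]
  simpa using alive_le_neverStop D Q σ θ t i

/-- If action `H` is taken in absorbing states only, then the sender never gains from stopping. -/
theorem probActionH_le_neverStop (D : SignalStructure S) {Q : Protocol S m}
    (ha : ∀ i, ¬ Q.IsAbsorbing i → (Q.a i : ℝ) = 0) (σ : Strategy m) (θ : Nature) :
    probActionH D Q σ θ ≤ probActionH D Q (neverStop m) θ := by
  refine Finset.sum_le_sum fun i _ => ?_
  by_cases hi : Q.IsAbsorbing i
  · exact mul_le_mul_of_nonneg_right (endProb_le_neverStop D σ θ hi) (Q.a i).2.1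
  · rw [ha i hi, mul_zero, mul_zero]

theorem neverStop_mem_bestResponses {p : ℝ} (hp0 : 0 < p) (hp1 : p < 1) (D : SignalStructure S)
    {Q : Protocol S m} (ha : ∀ i, ¬ Q.IsAbsorbing i → (Q.a i : ℝ) = 0) :
    neverStop m ∈ bestResponses p D Q := fun σ =>
  add_le_add (mul_le_mul_of_nonneg_left (probActionH_le_neverStop D ha σ _) hp0.le)
    (mul_le_mul_of_nonneg_left (probActionH_le_neverStop D ha σ _) (sub_nonneg.2 hp1.le))

/-- Never stopping is weakly better in each nature separately. Both natures have positive prior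
weight, so a best response cannot fall short in either. -/
theorem probActionH_eq_of_mem_bestResponses {p : ℝ} (hp0 : 0 < p) (hp1 : p < 1)
    {D : SignalStructure S} {Q : Protocol S m} (ha : ∀ i, ¬ Q.IsAbsorbing i → (Q.a i : ℝ) = 0)
    {σ : Strategy m} (hσ : σ ∈ bestResponses p D Q) (θ : Nature) :
    probActionH D Q σ θ = probActionH D Q (neverStop m) θ := by
  have h := hσ (neverStop m)
  have hH := probActionH_le_neverStop D ha σ Nature.H
  have hL := probActionH_le_neverStop D ha σ Nature.L
  unfold senderPayoff at h
  have h1 := mul_le_mul_of_nonneg_left hH hp0.le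
  have h2 := mul_le_mul_of_nonneg_left hL (sub_nonneg.2 hp1.le)
  cases θ
  · exact le_antisymm hH (le_of_mul_le_mul_left (by linarith) hp0)
  · exact le_antisymm hL (le_of_mul_le_mul_left (by linarith) (sub_pos.2 hp1))

/-- If the chain absorbs, the game ends almost surely. -/
theorem tendsto_alive (D : SignalStructure S) {Q : Protocol S m} (σ : Strategy m) (θ : Nature)
    (hA : Absorbs (Q.chain D θ) {i | Q.IsAbsorbing i}) (i : Fin m) :
    Tendsto (fun t => alive D Q σ θ t i) atTop (𝓝 0) := by
  classical
  by_cases hi : Q.IsAbsorbing i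
  · have := (summable_endProb D Q σ θ i).tendsto_atTop_zero
    simpa only [endsAt_absorbing hi, mul_one] using this
  -- `w` is the expected time to absorption, used as a Lyapunov function: each period its mean falls
  -- by at least the mass alive at `i`, so these masses are summable.
  obtain ⟨w, hwB, hw⟩ := hA.exists_solution (fun j => if Q.IsAbsorbing j then 0 else 1)
  replace hwB : ∀ j, Q.IsAbsorbing j → w j = 0 := fun j hj => by simpa [hj] using hwB j hj
  replace hw : ∀ j, ¬ Q.IsAbsorbing j → w j = 1 + ∑ k, Q.chain D θ j k * w k := fun j hj => by
    simpa [hj] using hw j hj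
  have hw0 : ∀ j, 0 ≤ w j := hA.nonneg (fun j hj => (hwB j hj).ge) fun j hj => by
    rw [hw j hj]; linarith
  have step : ∀ t, ∑ j, alive D Q σ θ (t + 1) j * w j + alive D Q σ θ t i ≤
      ∑ j, alive D Q σ θ t j * w j := by
    intro t
    have h1 : ∑ j, alive D Q σ θ (t + 1) j * w j =
        ∑ k, alive D Q σ θ t k * ((1 - endsAt Q σ θ k) * ∑ j, Q.chain D θ k j * w j) := by
      simp only [alive, Finset.sum_mul, Finset.mul_sum]
      rw [Finset.sum_comm]
      exact Finset.sum_congr rfl fun k _ => Finset.sum_congr rfl fun j _ => by ring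
    have h2 : alive D Q σ θ t i = ∑ k, alive D Q σ θ t k * if k = i then 1 else 0 := by simp
    rw [h1, h2, ← Finset.sum_add_distrib]
    refine Finset.sum_le_sum fun k _ => ?_
    rw [← mul_add]
    refine mul_le_mul_of_nonneg_left ?_ (alive_nonneg D Q σ θ t k)
    by_cases hk : Q.IsAbsorbing k
    · have hki : k ≠ i := fun e => hi (e ▸ hk)
      simp [endsAt_absorbing hk, hwB k hk, hki]
    · have h3 : 0 ≤ ∑ j, Q.chain D θ k j * w j :=
        Finset.sum_nonneg fun j _ => mul_nonneg (chain_nonneg Q D θ k j) (hw0 j)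
      have h4 := (endsAt_mem Q σ θ k).1
      rw [hw k hk]
      split_ifs <;> nlinarith
  have hsum : ∀ T, ∑ t ∈ Finset.range T, alive D Q σ θ t i + ∑ j, alive D Q σ θ T j * w j ≤
      ∑ j, Q.g.1 j * w j := by
    intro T
    induction T with
    | zero => simp [alive]
    | succ T ih =>
      rw [Finset.sum_range_succ]
      linarith [step T]
  refine (summable_of_sum_range_le (c := ∑ j, Q.g.1 j * w j)
    (fun t => alive_nonneg D Q σ θ t i) fun T => ?_).tendsto_atTop_zero
  have : 0 ≤ ∑ j, alive D Q σ θ T j * w j :=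
    Finset.sum_nonneg fun j _ => mul_nonneg (alive_nonneg D Q σ θ T j) (hw0 j)
  linarith [hsum T]

theorem tendsto_sum_ended (D : SignalStructure S) (Q : Protocol S m) (σ : Strategy m) (θ : Nature)
    (h : Fin m → ℝ) :
    Tendsto (fun T => ∑ t ∈ Finset.range T, ∑ i, alive D Q σ θ t i * endsAt Q σ θ i * h i) atTop
      (𝓝 (∑ i, endProb D Q σ θ i * h i)) := by
  have : ∀ T, ∑ t ∈ Finset.range T, ∑ i, alive D Q σ θ t i * endsAt Q σ θ i * h i =
      ∑ i, (∑ t ∈ Finset.range T, alive D Q σ θ t i * endsAt Q σ θ i) * h i := fun T => by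
    rw [Finset.sum_comm]
    simp only [Finset.sum_mul]
  simp only [this]
  exact tendsto_finsetSum _ fun i _ =>
    ((summable_endProb D Q σ θ i).hasSum.tendsto_sum_nat).mul_const _

theorem sum_endProb (D : SignalStructure S) {Q : Protocol S m} (σ : Strategy m) (θ : Nature)
    (hA : Absorbs (Q.chain D θ) {i | Q.IsAbsorbing i}) : ∑ i, endProb D Q σ θ i = 1 := by
  have h1 := (tendsto_sum_ended D Q σ θ fun _ => 1).add
    (tendsto_finsetSum Finset.univ fun i _ => tendsto_alive D σ θ hA i)
  simp only [mul_one, sum_ended_add_alive, Finset.sum_const_zero, add_zero] at h1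
  exact (tendsto_nhds_unique tendsto_const_nhds h1).symm

theorem probActionH_add_probActionL (D : SignalStructure S) (Q : Protocol S m) (σ : Strategy m)
    (θ : Nature) : probActionH D Q σ θ + probActionL D Q σ θ = ∑ i, endProb D Q σ θ i := by
  rw [probActionH, probActionL, ← Finset.sum_add_distrib]
  exact Finset.sum_congr rfl fun i _ => by ring

/-- Optional stopping for the sender who never stops. -/
theorem probActionH_neverStop (D : SignalStructure S) {Q : Protocol S m} (θ : Nature)
    (hA : Absorbs (Q.chain D θ) {i | Q.IsAbsorbing i}) {h : Fin m → ℝ}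
    (ha : ∀ i, Q.IsAbsorbing i → h i = Q.a i)
    (hh : ∀ i, ¬ Q.IsAbsorbing i → h i = ∑ j, Q.chain D θ i j * h j) :
    probActionH D Q (neverStop m) θ = ∑ i, Q.g.1 i * h i := by
  -- Martingale identity for the stopped chain; the alive term vanishes in the limit.
  have inv : ∀ T, ∑ t ∈ Finset.range T, ∑ i, alive D Q (neverStop m) θ t i *
      endsAt Q (neverStop m) θ i * h i + ∑ i, alive D Q (neverStop m) θ T i * h i =
      ∑ i, Q.g.1 i * h i := by
    intro T
    induction T with
    | zero => simp [alive]
    | succ T ih =>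
      have h1 : ∑ j, alive D Q (neverStop m) θ (T + 1) j * h j =
          ∑ k, alive D Q (neverStop m) θ T k * (1 - endsAt Q (neverStop m) θ k) *
            ∑ j, Q.chain D θ k j * h j := by
        simp only [alive, Finset.sum_mul, Finset.mul_sum]
        rw [Finset.sum_comm]
        exact Finset.sum_congr rfl fun k _ => Finset.sum_congr rfl fun j _ => by ring
      rw [← ih, Finset.sum_range_succ, add_assoc, add_right_inj, h1, ← Finset.sum_add_distrib]
      refine Finset.sum_congr rfl fun k _ => ?_
      by_cases hk : Q.IsAbsorbing k
      · rw [endsAt_absorbing hk]; ring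
      · rw [endsAt_neverStop hk, ← hh k hk]; ring
  have h1 := (tendsto_sum_ended D Q (neverStop m) θ h).add
    (tendsto_finsetSum Finset.univ fun i _ => (tendsto_alive D (neverStop m) θ hA i).mul_const (h i))
  simp only [inv, zero_mul, Finset.sum_const_zero, add_zero] at h1
  rw [tendsto_nhds_unique tendsto_const_nhds h1, probActionH]
  refine Finset.sum_congr rfl fun i _ => ?_
  by_cases hi : Q.IsAbsorbing i
  · rw [ha i hi]
  · have : endProb D Q (neverStop m) θ i = 0 := by
      simp [endProb, endsAt_neverStop hi]
    rw [this, zero_mul, zero_mul]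

/-- Boundedness is needed for the real `sSup` in `optimalReceiverPayoff` to dominate its members. -/
theorem receiverPayoff_le_one {p : ℝ} (hp0 : 0 < p) (hp1 : p < 1) (D : SignalStructure S)
    (Q : Protocol S m) (σ : Strategy m) : receiverPayoff p D Q σ ≤ 1 := by
  have hsum : ∀ θ, ∑ i, endProb D Q σ θ i ≤ 1 := fun θ => by
    have h := tendsto_sum_ended D Q σ θ fun _ => 1
    simp only [mul_one] at h
    refine le_of_tendsto' h fun T => ?_
    have h2 : 0 ≤ ∑ k, alive D Q σ θ T k := Finset.sum_nonneg fun k _ => alive_nonneg D Q σ θ T k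
    linarith [sum_ended_add_alive D Q σ θ T]
  have hH : probActionH D Q σ Nature.H ≤ 1 := (Finset.sum_le_sum fun i _ =>
    mul_le_of_le_one_right (endProb_nonneg D Q σ _ i) (Q.a i).2.2).trans (hsum _)
  have hL : probActionL D Q σ Nature.L ≤ 1 := (Finset.sum_le_sum fun i _ =>
    mul_le_of_le_one_right (endProb_nonneg D Q σ _ i) (by linarith [(Q.a i).2.1])).trans (hsum _)
  unfold receiverPayoff
  nlinarith

theorem receiverPayoff_le_optimal {p : ℝ} (hp0 : 0 < p) (hp1 : p < 1) (D : SignalStructure S)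
    {Q : Protocol S m} {σ : Strategy m} (hσ : σ ∈ bestResponses p D Q) :
    receiverPayoff p D Q σ ≤ optimalReceiverPayoff p D m :=
  le_csSup ⟨1, by rintro _ ⟨Q, σ, _, rfl⟩; exact receiverPayoff_le_one hp0 hp1 D Q σ⟩
    ⟨Q, σ, hσ, rfl⟩

end Payoffs

/-! ### Extreme likelihood ratios -/

section Gamma

variable {S : Type*} [Fintype S]

theorem SignalStructure.nonempty (D : SignalStructure S) : Nonempty S := by
  by_contra h
  have := not_nonempty_iff.1 h
  simpa using D.sum_prob Nature.H

theorem SignalStructure.exists_extreme (D : SignalStructure S) : ∃ s₁ s₀ : S,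
    (∀ s, D.prob Nature.H s / D.prob Nature.L s ≤ D.prob Nature.H s₁ / D.prob Nature.L s₁) ∧
    (∀ s, D.prob Nature.H s₀ / D.prob Nature.L s₀ ≤ D.prob Nature.H s / D.prob Nature.L s) ∧
    D.gamma = (D.prob Nature.H s₁ / D.prob Nature.L s₁) /
      (D.prob Nature.H s₀ / D.prob Nature.L s₀) := by
  have := D.nonempty
  obtain ⟨s₁, h₁⟩ := Finite.exists_max fun s => D.prob Nature.H s / D.prob Nature.L s
  obtain ⟨s₀, h₀⟩ := Finite.exists_min fun s => D.prob Nature.H s / D.prob Nature.L s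
  refine ⟨s₁, s₀, h₁, h₀, ?_⟩
  rw [gamma]
  congr 1
  · exact le_antisymm (ciSup_le h₁) (le_ciSup (f := fun s => D.prob Nature.H s / D.prob Nature.L s)
      (Finite.bddAbove_range _) s₁)
  · exact le_antisymm (ciInf_le (f := fun s => D.prob Nature.H s / D.prob Nature.L s)
      (Finite.bddBelow_range _) s₀) (le_ciInf h₀)

end Gamma

/-! ### The odds constraint for parsimonious protocols -/

section Parsimonious

variable {S : Type*} [Fintype S] {m : ℕ}

theorem chain_of_isAbsorbing {Q : Protocol S m} {i : Fin m} (hi : Q.IsAbsorbing i)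
    (D : SignalStructure S) (θ : Nature) : Q.chain D θ i i = 1 := by
  simp [Protocol.chain, hi _, D.sum_prob]

theorem chain_off_of_isAbsorbing {Q : Protocol S m} {i : Fin m} (hi : Q.IsAbsorbing i)
    (D : SignalStructure S) (θ : Nature) {j : Fin m} (hj : j ≠ i) : Q.chain D θ i j = 0 := by
  have h1 := sum_chain Q D θ i
  rw [← Finset.add_sum_erase _ _ (Finset.mem_univ i), chain_of_isAbsorbing hi] at h1
  have h2 : ∑ k ∈ Finset.univ.erase i, Q.chain D θ i k = 0 := by linarith
  exact (Finset.sum_eq_zero_iff_of_nonneg fun k _ => chain_nonneg Q D θ i k).1 h2 j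
    (by simp [hj])

theorem not_isTransient_of_isAbsorbing {Q : Protocol S m} {i : Fin m} (hi : Q.IsAbsorbing i)
    (D : SignalStructure S) (θ : Nature) : ¬ IsTransient (Q.chain D θ) i := by
  intro h
  have h1 : avoidProb (Q.chain D θ) i 1 i = 0 := by
    refine Finset.sum_eq_zero fun j _ => ?_
    split_ifs with hj
    · rfl
    · rw [chain_off_of_isAbsorbing hi D θ hj, zero_mul]
  have h2 : ⨅ n, avoidProb (Q.chain D θ) i n i ≤ avoidProb (Q.chain D θ) i 1 i :=
    ciInf_le ⟨0, by
      rintro _ ⟨n, rfl⟩; exact avoidProb_nonneg (chain_nonneg Q D θ) i n i⟩ 1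
  exact absurd h (by rw [IsTransient]; linarith)

/-- In a parsimonious protocol, the odds of action `H` in the two states of nature differ by a
factor of at most `γ ^ (m - 2)`. -/
theorem Protocol.IsParsimonious.payoffs {p : ℝ} (hp0 : 0 < p) (hp1 : p < 1)
    {D : SignalStructure S} {Q : Protocol S m} (hQ : Q.IsParsimonious D) {σ : Strategy m}
    (hσ : σ ∈ bestResponses p D Q) :
    ∃ x y : ℝ, 0 ≤ x ∧ x ≤ 1 ∧ 0 ≤ y ∧ y ≤ 1 ∧
      x * (1 - y) ≤ D.gamma ^ (m - 2) * ((1 - x) * y) ∧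
      receiverPayoff p D Q σ = p * x + (1 - p) * (1 - y) ∧
      senderPayoff p D Q σ = p * x + (1 - p) * y := by
  classical
  obtain ⟨lo, hi, hlo, halo, hhi, hahi, hrest⟩ := hQ
  have hne : lo ≠ hi := fun e => by rw [e, hahi] at halo; norm_num at halo
  -- Absorbing states are not transient, so there are exactly two of them; this yields the exponent
  -- m - 2.
  have habs : ∀ i, Q.IsAbsorbing i ↔ i = lo ∨ i = hi := fun i => by
    refine ⟨fun h => ?_, by rintro (rfl | rfl) <;> assumption⟩
    by_contra! hc
    exact not_isTransient_of_isAbsorbing h D Nature.H ((hrest i hc.1 hc.2).1 _)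
  have hA : ∀ θ, Absorbs (Q.chain D θ) {i | Q.IsAbsorbing i} := fun θ =>
    absorbs_of_isTransient (chain_nonneg Q D θ) (sum_chain Q D θ) fun i hi => by
      rw [Set.mem_ofPred_eq, habs, not_or] at hi
      exact (hrest i hi.1 hi.2).1 θ
  have ha : ∀ i, ¬ Q.IsAbsorbing i → (Q.a i : ℝ) = 0 := fun i hi => by
    rw [habs, not_or] at hi
    exact (hrest i hi.1 hi.2).2
  choose h hB hh using fun θ => (hA θ).exists_solution
    (fun j => if Q.IsAbsorbing j then (Q.a j : ℝ) else 0)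
  replace hB : ∀ θ j, Q.IsAbsorbing j → h θ j = Q.a j := fun θ j hj => by
    simpa [hj] using hB θ j hj
  replace hh : ∀ θ j, ¬ Q.IsAbsorbing j → h θ j = ∑ k, Q.chain D θ j k * h θ k := fun θ j hj => by
    simpa [hj] using hh θ j hj
  have hharm : ∀ θ, HarmonicOff (Q.chain D θ) {i | Q.IsAbsorbing i} (h θ) := fun θ =>
    ⟨fun j hj => hh θ j hj, fun j hj => by rw [hB θ j hj]; exact (Q.a j).2.1,
      fun j hj => by rw [hB θ j hj]; exact (Q.a j).2.2⟩
  have hq : ∀ θ, probActionH D Q σ θ = ∑ i, Q.g.1 i * h θ i := fun θ => by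
    rw [probActionH_eq_of_mem_bestResponses hp0 hp1 ha hσ,
      probActionH_neverStop D θ (hA θ) (hB θ) (hh θ)]
  have hqL : ∀ θ, probActionL D Q σ θ = 1 - ∑ i, Q.g.1 i * h θ i := fun θ => by
    have := probActionH_add_probActionL D Q σ θ
    rw [sum_endProb D σ θ (hA θ), hq] at this
    linarith
  have hq0 : ∀ θ, 0 ≤ ∑ i, Q.g.1 i * h θ i := fun θ =>
    Finset.sum_nonneg fun i _ => mul_nonneg (Q.g.2.1 i) ((hharm θ).nonneg_all (hA θ) i)
  have hq1 : ∀ θ, ∑ i, Q.g.1 i * h θ i ≤ 1 := fun θ => by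
    rw [← Q.g.2.2]
    exact Finset.sum_le_sum fun i _ => mul_le_of_le_one_right (Q.g.2.1 i)
      ((hharm θ).le_one_all (sum_chain Q D θ) (hA θ) i)
  refine ⟨_, _, hq0 Nature.H, hq1 Nature.H, hq0 Nature.L, hq1 Nature.L, ?_, ?_, ?_⟩
  · obtain ⟨s₁, s₀, h₁, h₀, hγ⟩ := D.exists_extreme
    have hL := D.prob_pos Nature.L
    have hc : 0 < D.prob Nature.H s₀ / D.prob Nature.L s₀ := div_pos (D.prob_pos _ _) (hL _)
    -- The chain of nature `L` is the reference; c and C are the smallest and largest likelihood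
    -- ratios, so C / c = γ.
    have := odds_le (chain_nonneg Q D Nature.L) (sum_chain Q D Nature.L) (sum_chain Q D Nature.H)
      (hA _) hc (C := D.prob Nature.H s₁ / D.prob Nature.L s₁)
      (fun i k => ?_) (fun i k => ?_) (hharm _) (hharm _)
      (fun j hj => by rw [hB _ j hj, hB _ j hj]) Q.g.2.1 Q.g.2.2 ({lo, hi}ᶜ : Finset (Fin m))
      (fun i => by simp [habs])
    · rwa [← hγ, Finset.card_compl, Fintype.card_fin, Finset.card_pair hne] at this
    · rw [Protocol.chain, Protocol.chain, Finset.mul_sum]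
      refine Finset.sum_le_sum fun s _ => ?_
      rw [← mul_assoc]
      exact mul_le_mul_of_nonneg_right ((le_div_iff₀ (hL s)).1 (h₀ s)) ((Q.f i s).2.1 k)
    · rw [Protocol.chain, Protocol.chain, Finset.mul_sum]
      refine Finset.sum_le_sum fun s _ => ?_
      rw [← mul_assoc]
      exact mul_le_mul_of_nonneg_right ((div_le_iff₀ (hL s)).1 (h₁ s)) ((Q.f i s).2.1 k)
  · rw [receiverPayoff, hq, hqL]
  · rw [senderPayoff, hq, hq]

end Parsimonious

/-! ### Protocols that bound the optimal value from below -/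

section Constructions

variable {S : Type*} [Fintype S]

/-- A protocol with absorbing states in which the sender never stops early attains the receiver
payoff given by the harmonic extensions `h θ` of the action rule. -/
theorem le_optimal_of_harmonic {m : ℕ} {p : ℝ} (hp0 : 0 < p) (hp1 : p < 1) (D : SignalStructure S)
    (Q : Protocol S m) (ha : ∀ i, ¬ Q.IsAbsorbing i → (Q.a i : ℝ) = 0)
    (hA : ∀ θ, Absorbs (Q.chain D θ) {i | Q.IsAbsorbing i}) {h : Nature → Fin m → ℝ}
    (hB : ∀ θ i, Q.IsAbsorbing i → h θ i = Q.a i)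
    (hh : ∀ θ i, ¬ Q.IsAbsorbing i → h θ i = ∑ j, Q.chain D θ i j * h θ j) :
    p * ∑ i, Q.g.1 i * h Nature.H i + (1 - p) * (1 - ∑ i, Q.g.1 i * h Nature.L i) ≤
      optimalReceiverPayoff p D m := by
  have hq := fun θ => probActionH_neverStop D θ (hA θ) (hB θ) (hh θ)
  have hL := probActionH_add_probActionL D Q (neverStop m) Nature.L
  rw [sum_endProb D _ _ (hA _), hq] at hL
  have := receiverPayoff_le_optimal hp0 hp1 D (neverStop_mem_bestResponses hp0 hp1 D ha)
  rw [receiverPayoff, hq] at this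
  rwa [← eq_sub_of_add_eq' hL]

/-- The Dirac distribution, moved with probability `w` from `i` to `j`. -/
noncomputable def lazyMove {m : ℕ} (i j : Fin m) (w : Set.Icc (0 : ℝ) 1) : stdSimplex ℝ (Fin m) :=
  ⟨fun k => (1 - w) * Pi.single (M := fun _ => ℝ) i 1 k + w * Pi.single (M := fun _ => ℝ) j 1 k,
    fun k => add_nonneg
      (mul_nonneg (sub_nonneg.2 w.2.2) (Pi.single_nonneg (α := fun _ => ℝ) |>.2 zero_le_one k))
      (mul_nonneg w.2.1 (Pi.single_nonneg (α := fun _ => ℝ) |>.2 zero_le_one k)), by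
    rw [Finset.sum_add_distrib, ← Finset.mul_sum, ← Finset.mul_sum]
    simp⟩

theorem lazyMove_apply {m : ℕ} (i j : Fin m) (w : Set.Icc (0 : ℝ) 1) (k : Fin m) :
    (lazyMove i j w).1 k = (1 - w) * (if k = i then 1 else 0) + w * (if k = j then 1 else 0) := by
  simp [lazyMove, Pi.single_apply]

theorem sum_lazyMove_mul {m : ℕ} (i j : Fin m) (w : Set.Icc (0 : ℝ) 1) (h : Fin m → ℝ) :
    ∑ k, (lazyMove i j w).1 k * h k = h i + w * (h j - h i) := by
  simp only [lazyMove_apply, add_mul, Finset.sum_add_distrib, mul_assoc, ← Finset.mul_sum, ite_mul,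
    one_mul, zero_mul, Finset.sum_ite_eq', Finset.mem_univ, if_true]
  ring

/-- With every state absorbing the sender has no influence; v = 0 and v = 1 give 1 - p and p. -/
theorem const_le_optimal {m : ℕ} (hm : 0 < m) {p : ℝ} (hp0 : 0 < p) (hp1 : p < 1)
    (D : SignalStructure S) (v : Set.Icc (0 : ℝ) 1) :
    p * v + (1 - p) * (1 - v) ≤ optimalReceiverPayoff p D m := by
  let Q : Protocol S m :=
    { f := fun i _ => lazyMove i i 0
      g := lazyMove ⟨0, hm⟩ ⟨0, hm⟩ 0
      a := fun _ => v }
  have habs : ∀ i, Q.IsAbsorbing i := fun i s => by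
    change (lazyMove i i 0).1 i = 1
    simp [lazyMove_apply]
  have := le_optimal_of_harmonic hp0 hp1 D Q (fun i hi => absurd (habs i) hi)
    (fun θ f hf _ j => hf j (habs j)) (h := fun _ _ => v) (fun _ _ _ => rfl)
    (fun θ i hi => absurd (habs i) hi)
  simpa [← Finset.sum_mul, Q.g.2.2] using this

open Classical in
/-- The reset protocol. State `0` and the last state are absorbing. The signal `s₁` moves the
state up by one, and `s₀` moves it back to `1`, from where it moves to `0`; upward moves
occur with probability `ε` only, and moves from `1` to `0` with probability `d` only. Action `H` is taken in the last state. -/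
noncomputable def resetProtocol (s₁ s₀ : S) (n : ℕ) (ε d : Set.Icc (0 : ℝ) 1) :
    Protocol S (n + 3) where
  f i s := if i = 0 ∨ i = Fin.last (n + 2) then lazyMove i i 0
    else if s = s₁ then lazyMove i ⟨min (i.1 + 1) (n + 2), by omega⟩ ε
    else if s = s₀ then (if i = 1 then lazyMove i 0 d else lazyMove i 1 1)
    else lazyMove i i 0
  g := lazyMove 1 1 0
  a i := if i = Fin.last (n + 2) then 1 else 0

theorem sum_chain_resetProtocol {s₁ s₀ : S} (hs : s₁ ≠ s₀) (n : ℕ) (ε d : Set.Icc (0 : ℝ) 1)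
    (D : SignalStructure S) (θ : Nature) {i : Fin (n + 3)} (h0 : i ≠ 0)
    (hl : i ≠ Fin.last (n + 2)) (h : Fin (n + 3) → ℝ) :
    ∑ j, (resetProtocol s₁ s₀ n ε d).chain D θ i j * h j = h i +
      (D.prob θ s₁ * ((ε : ℝ) *
        (h ⟨min (i.1 + 1) (n + 2), by omega⟩ - h i)) +
      D.prob θ s₀ * (if i = 1 then d * (h 0 - h i) else h 1 - h i)) := by
  classical
  have h1 : ∑ j, (resetProtocol s₁ s₀ n ε d).chain D θ i j * h j =
      ∑ s, D.prob θ s * ∑ j, ((resetProtocol s₁ s₀ n ε d).f i s).1 j * h j := by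
    simp only [Protocol.chain, Finset.sum_mul, Finset.mul_sum]
    rw [Finset.sum_comm]
    exact Finset.sum_congr rfl fun s _ => Finset.sum_congr rfl fun j _ => by ring
  have h2 : ∀ s, ∑ j, ((resetProtocol s₁ s₀ n ε d).f i s).1 j * h j = h i +
      ((if s = s₁ then ((ε : ℝ) *
        (h ⟨min (i.1 + 1) (n + 2), by omega⟩ - h i)) else 0) +
      (if s = s₀ then (if i = 1 then d * (h 0 - h i) else h 1 - h i) else 0)) := fun s => by
    simp only [resetProtocol, h0, hl, or_self, if_false]
    by_cases hs1 : s = s₁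
    · have : s ≠ s₀ := fun e => hs (hs1.symm.trans e)
      simp only [hs1, if_true, sum_lazyMove_mul, hs, if_false, add_zero]
    · by_cases hs0 : s = s₀
      · simp only [hs0, Ne.symm hs, if_false, if_true, zero_add]
        split_ifs <;> simp [sum_lazyMove_mul]
      · simp [hs1, hs0, sum_lazyMove_mul]
  simp only [h1, h2, mul_add, Finset.sum_add_distrib, ← Finset.sum_mul, D.sum_prob, one_mul,
    mul_ite, mul_zero, Finset.sum_ite_eq', Finset.mem_univ, if_true]

theorem resetProtocol_isAbsorbing {R : Type*} {s₁ s₀ : R} {n : ℕ} {ε d : Set.Icc (0 : ℝ) 1}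
    (hε : 0 < (ε : ℝ)) (i : Fin (n + 3)) :
    (resetProtocol s₁ s₀ n ε d).IsAbsorbing i ↔ i = 0 ∨ i = Fin.last (n + 2) := by
  constructor
  · intro h
    by_contra hi
    have h1 := h s₁
    obtain ⟨hi0, hil⟩ := not_or.1 hi
    have hup : i ≠ ⟨min (i.1 + 1) (n + 2), by omega⟩ := fun e => by
      have h2 := congrArg Fin.val e
      have h3 : i.1 ≠ n + 2 := fun e => hil (Fin.ext e)
      simp only at h2
      omega
    simp only [resetProtocol, hi, if_false, if_true, lazyMove_apply, if_neg hup] at h1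
    linarith
  · intro hi s
    simp [resetProtocol, hi, lazyMove_apply]

/-- The highest state of a set of transient states can move up and out of the set, since ε > 0. -/
theorem resetProtocol_absorbs {s₁ s₀ : S} {n : ℕ} {ε d : Set.Icc (0 : ℝ) 1}
    (hε : 0 < (ε : ℝ)) (D : SignalStructure S) (θ : Nature) :
    Absorbs ((resetProtocol s₁ s₀ n ε d).chain D θ)
      {i | (resetProtocol s₁ s₀ n ε d).IsAbsorbing i} := by
  refine absorbs_of_forall_closed (chain_nonneg _ D θ) (sum_chain _ D θ) fun C hC hCB => ?_
  obtain ⟨i, hi, hmax⟩ := C.toFinite.exists_maximal hC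
  have hiB := hCB i hi
  rw [Set.mem_ofPred_eq, resetProtocol_isAbsorbing hε] at hiB
  have hlt : i < ⟨min (i.1 + 1) (n + 2), by omega⟩ := by
    have h3 : i.1 ≠ n + 2 := fun e => hiB (Or.inr (Fin.ext e))
    rw [Fin.lt_def]
    simp only
    omega
  refine ⟨i, hi, _, fun hmem => absurd (hmax hmem hlt.le) (not_le.2 hlt), ne_of_gt ?_⟩
  refine lt_of_lt_of_le ?_ (Finset.single_le_sum
    (f := fun s => D.prob θ s * ((resetProtocol s₁ s₀ n ε d).f i s).1 _)
    (fun s _ => mul_nonneg (D.prob_pos θ s).le (((resetProtocol s₁ s₀ n ε d).f i s).2.1 _))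
    (Finset.mem_univ s₁))
  refine mul_pos (D.prob_pos θ s₁) ?_
  simp only [resetProtocol, hiB, if_false, if_true, lazyMove_apply, if_neg hlt.ne']
  simp [hε]

/-- With a, b the probabilities of `s₁`, `s₀`, a climb step precedes a reset with probability u =
εa/(εa+b). From state 1 the escape rate to the top is εa uⁿ and to the bottom b d; x is the share of
the former. -/
theorem reset_le_optimal {p : ℝ} (hp0 : 0 < p) (hp1 : p < 1) (D : SignalStructure S) {s₁ s₀ : S}
    (hs : s₁ ≠ s₀) (n : ℕ) {ε d : ℝ} (hε : 0 < ε) (hε1 : ε ≤ 1) (hd : 0 < d) (hd1 : d ≤ 1)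
    {x : Nature → ℝ} (hx : ∀ θ, x θ =
      ε * D.prob θ s₁ * (ε * D.prob θ s₁ / (ε * D.prob θ s₁ + D.prob θ s₀)) ^ n /
      (ε * D.prob θ s₁ * (ε * D.prob θ s₁ / (ε * D.prob θ s₁ + D.prob θ s₀)) ^ n +
        D.prob θ s₀ * d)) :
    p * x Nature.H + (1 - p) * (1 - x Nature.L) ≤ optimalReceiverPayoff p D (n + 3) := by
  have h1l : (1 : Fin (n + 3)) ≠ Fin.last (n + 2) := fun e => by
    have := congrArg Fin.val e
    simp at this
  -- From i ≥ 2, either the remaining n + 2 - i climbs succeed without a reset, or the chain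
  -- restarts at 1, worth `x θ`.
  let h : Nature → Fin (n + 3) → ℝ := fun θ i =>
    if i = 0 then 0 else if i = 1 then x θ else x θ +
      (ε * D.prob θ s₁ / (ε * D.prob θ s₁ + D.prob θ s₀)) ^ (n + 2 - i.1) * (1 - x θ)
  have hdef : ∀ θ i, h θ i = if i = 0 then 0 else if i = 1 then x θ else x θ +
      (ε * D.prob θ s₁ / (ε * D.prob θ s₁ + D.prob θ s₀)) ^ (n + 2 - i.1) * (1 - x θ) :=
    fun _ _ => rfl
  have := le_optimal_of_harmonic hp0 hp1 D
    (resetProtocol s₁ s₀ n ⟨ε, hε.le, hε1⟩ ⟨d, hd.le, hd1⟩) (fun i hi => ?_)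
    (fun θ => resetProtocol_absorbs hε D θ) (h := h) (fun θ i hi => ?_) (fun θ i hi => ?_)
  · have hg : ∀ θ, ∑ i, (resetProtocol s₁ s₀ n ⟨ε, hε.le, hε1⟩ ⟨d, hd.le, hd1⟩).g.1 i * h θ i =
        x θ := fun θ => by
      simp only [resetProtocol]
      rw [sum_lazyMove_mul, sub_self, mul_zero, add_zero, hdef]
      simp
    rwa [hg, hg] at this
  · rw [resetProtocol_isAbsorbing hε] at hi
    simp [resetProtocol, (not_or.1 hi).2]
  · rw [resetProtocol_isAbsorbing hε] at hi
    rcases hi with rfl | rfl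
    · simp [resetProtocol, hdef]
    · simp [resetProtocol, hdef, h1l.symm]
  · rw [resetProtocol_isAbsorbing hε] at hi
    obtain ⟨hi0, hil⟩ := not_or.1 hi
    rw [sum_chain_resetProtocol hs n _ _ D θ hi0 hil]
    have ha := D.prob_pos θ s₁
    have hb := D.prob_pos θ s₀
    have hxθ := hx θ
    set a := D.prob θ s₁
    set b := D.prob θ s₀
    have hil' : i.1 ≠ n + 2 := fun e => hil (Fin.ext e)
    have hi0' : i.1 ≠ 0 := fun e => hi0 (Fin.ext e)
    have hup : h θ ⟨min (i.1 + 1) (n + 2), by omega⟩ =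
        x θ + (ε * a / (ε * a + b)) ^ (n + 1 - i.1) * (1 - x θ) := by
      rw [hdef, if_neg, if_neg]
      · simp only
        congr 3
        omega
      · intro e
        have := congrArg Fin.val e
        simp at this
        omega
      · intro e
        have := congrArg Fin.val e
        simp at this
    rw [hup, left_eq_add]
    set u := ε * a / (ε * a + b) with hu
    have hupos : 0 < u := by positivity
    by_cases hi1 : i = 1
    · subst hi1
      have e1 : h θ 1 = x θ := by simp [hdef]
      have e0 : h θ 0 = 0 := by simp [hdef]
      simp only [if_true, e1, e0, Fin.val_one, Nat.add_sub_cancel]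
      have hden : ε * a * u ^ n + b * d ≠ 0 := by positivity
      rw [eq_div_iff hden] at hxθ
      linear_combination (-1 : ℝ) * hxθ
    · have hi1' : i.1 ≠ 1 := fun e => hi1 (Fin.ext e)
      have e1 : h θ 1 = x θ := by simp [hdef]
      have ei : h θ i = x θ + u ^ (n + 1 - i.1 + 1) * (1 - x θ) := by
        rw [hdef, if_neg hi0, if_neg hi1]
        congr 3
        omega
      simp only [hi1, if_false, e1, ei]
      have hu' : u * (ε * a + b) = ε * a := by
        rw [hu]; field_simp
      rw [pow_succ]
      linear_combination (-1 : ℝ) * u ^ (n + 1 - i.1) * (1 - x θ) * hu'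

/-- As ε → 0, u is asymptotically ε times the ratio of signal probabilities, so the odds of `H`
become a pure power of this ratio, with c a free scale. -/
theorem tendsto_le_optimal {p : ℝ} (hp0 : 0 < p) (hp1 : p < 1) (D : SignalStructure S) {s₁ s₀ : S}
    (hs : s₁ ≠ s₀) (n : ℕ) {c : ℝ} (hc : 0 < c) {x : Nature → ℝ} (hx : ∀ θ, x θ =
      (D.prob θ s₁ / D.prob θ s₀) ^ (n + 1) / ((D.prob θ s₁ / D.prob θ s₀) ^ (n + 1) + c)) :
    p * x Nature.H + (1 - p) * (1 - x Nature.L) ≤ optimalReceiverPayoff p D (n + 3) := by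
  let y : ℝ → Nature → ℝ := fun ε θ =>
    D.prob θ s₁ * (D.prob θ s₁ / (ε * D.prob θ s₁ + D.prob θ s₀)) ^ n /
      (D.prob θ s₁ * (D.prob θ s₁ / (ε * D.prob θ s₁ + D.prob θ s₀)) ^ n + D.prob θ s₀ * c)
  have hlim : ∀ θ, Tendsto (fun ε => y ε θ) (𝓝[>] 0) (𝓝 (x θ)) := fun θ => by
    have ha := D.prob_pos θ s₁
    have hb := D.prob_pos θ s₀
    have h1 : Tendsto (fun ε : ℝ => ε * D.prob θ s₁ + D.prob θ s₀) (𝓝[>] 0)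
        (𝓝 (0 * D.prob θ s₁ + D.prob θ s₀)) :=
      ((tendsto_id.mul_const _).add_const _).mono_left nhdsWithin_le_nhds
    rw [zero_mul, zero_add] at h1
    have h2 := (((tendsto_const_nhds (x := D.prob θ s₁)).div h1 hb.ne').pow n).const_mul (D.prob θ s₁)
    have h3 := h2.div (h2.add_const (D.prob θ s₀ * c)) (by positivity)
    have hr : D.prob θ s₀ * (D.prob θ s₁ / D.prob θ s₀) = D.prob θ s₁ := by field_simp
    have hxθ : D.prob θ s₁ * (D.prob θ s₁ / D.prob θ s₀) ^ n /
        (D.prob θ s₁ * (D.prob θ s₁ / D.prob θ s₀) ^ n + D.prob θ s₀ * c) = x θ := by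
      rw [hx, div_eq_div_iff (by positivity) (by positivity)]
      linear_combination (-(c * (D.prob θ s₁ / D.prob θ s₀) ^ n)) * hr
    rw [hxθ] at h3
    exact h3
  have hlim2 := ((hlim Nature.H).const_mul p).add (((hlim Nature.L).const_sub 1).const_mul (1 - p))
  refine le_of_tendsto hlim2 ?_
  have hd : Tendsto (fun ε : ℝ => c * ε ^ (n + 1)) (𝓝[>] 0) (𝓝 (c * 0 ^ (n + 1))) :=
    ((tendsto_id.pow (n + 1)).const_mul c).mono_left nhdsWithin_le_nhds
  rw [zero_pow n.succ_ne_zero, mul_zero] at hd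
  filter_upwards [self_mem_nhdsWithin, hd.eventually (eventually_le_nhds zero_lt_one),
    nhdsWithin_le_nhds (eventually_le_nhds (zero_lt_one' ℝ))] with ε hε hd1 hε1
  rw [Set.mem_Ioi] at hε
  -- Reaching the top takes n + 1 moves of order ε, so this order of d keeps the two escape rates
  -- comparable.
  refine reset_le_optimal hp0 hp1 D hs n hε hε1 (d := c * ε ^ (n + 1)) (by positivity) hd1
    fun θ => ?_
  have ha := D.prob_pos θ s₁
  have hb := D.prob_pos θ s₀
  have e : (ε * D.prob θ s₁ / (ε * D.prob θ s₁ + D.prob θ s₀)) ^ n =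
      ε ^ n * (D.prob θ s₁ / (ε * D.prob θ s₁ + D.prob θ s₀)) ^ n := by
    rw [← mul_pow, mul_div_assoc]
  have hy : y ε θ = D.prob θ s₁ * (D.prob θ s₁ / (ε * D.prob θ s₁ + D.prob θ s₀)) ^ n /
      (D.prob θ s₁ * (D.prob θ s₁ / (ε * D.prob θ s₁ + D.prob θ s₀)) ^ n + D.prob θ s₀ * c) := rfl
  rw [hy, e, ← mul_div_mul_left _ _ (pow_pos hε (n + 1)).ne']
  congr 1 <;> ring

/-- Every point of the curve of pairs of error probabilities whose odds differ by the factor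
`γ ^ (m - 2)` is attained in the limit. -/
theorem curve_le_optimal {p : ℝ} (hp0 : 0 < p) (hp1 : p < 1) (D : SignalStructure S) {m : ℕ}
    (hm : 3 ≤ m) (hγ : D.gamma ≠ 1) {α : ℝ} (hα0 : 0 < α) (hα1 : α < 1) :
    p * (1 - α) + (1 - p) * (1 - (1 - α) / ((1 - α) + D.gamma ^ (m - 2) * α)) ≤
      optimalReceiverPayoff p D m := by
  obtain ⟨n, rfl⟩ := Nat.exists_eq_add_of_le' hm
  obtain ⟨s₁, s₀, -, -, hg⟩ := D.exists_extreme
  have hpos := D.prob_pos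
  have hs : s₁ ≠ s₀ := fun e => hγ (by
    rw [hg, e, div_self (div_pos (hpos _ _) (hpos _ _)).ne'])
  have hα : 0 < 1 - α := by linarith
  have hrH : 0 < D.prob Nature.H s₁ / D.prob Nature.H s₀ := div_pos (hpos _ _) (hpos _ _)
  have hrL : 0 < D.prob Nature.L s₁ / D.prob Nature.L s₀ := div_pos (hpos _ _) (hpos _ _)
  have hg' : D.prob Nature.H s₁ / D.prob Nature.H s₀ =
      D.gamma * (D.prob Nature.L s₁ / D.prob Nature.L s₀) := by
    have := hpos Nature.H s₁
    have := hpos Nature.H s₀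
    have := hpos Nature.L s₁
    have := hpos Nature.L s₀
    rw [hg]; field_simp
  have hg0 : 0 < D.gamma := by
    rw [hg' ] at hrH
    exact pos_of_mul_pos_left hrH hrL.le
  -- The scale c is solved from x(H) = 1 - α.
  have key := tendsto_le_optimal hp0 hp1 D hs n
    (c := (D.prob Nature.H s₁ / D.prob Nature.H s₀) ^ (n + 1) * (α / (1 - α)))
    (by positivity) (fun θ => rfl)
  convert key using 2
  · congr 1
    generalize (D.prob Nature.H s₁ / D.prob Nature.H s₀) = r at *
    field_simp
    ring
  · congr 2
    rw [hg', mul_pow, show n + 3 - 2 = n + 1 by omega]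
    generalize (D.prob Nature.L s₁ / D.prob Nature.L s₀) = r at *
    field_simp

end Constructions

/-! ### Near-optimal points of the constraint region -/

section Limits

/-- On the region above a hyperbola, `X + Y` close to its minimum forces `X` close to `Y`. -/
theorem tendsto_sub_of_hyperbola {X Y : ℕ → ℝ} {K s : ℝ} (hX : ∀ n, 0 ≤ X n) (hY : ∀ n, 0 ≤ Y n)
    (hXY : ∀ n, K ^ 2 ≤ X n * Y n) (hlim : Tendsto (fun n => X n + Y n) atTop (𝓝 s))
    (hs : s ≤ 2 * K) : Tendsto (fun n => Y n - X n) atTop (𝓝 0) := by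
  have hs0 : 0 ≤ s := ge_of_tendsto' hlim fun n => add_nonneg (hX n) (hY n)
  have h1 : Tendsto (fun n => (X n + Y n) ^ 2 - 4 * K ^ 2) atTop (𝓝 (s ^ 2 - 4 * K ^ 2)) :=
    (hlim.pow 2).sub_const _
  -- AM-GM with its defect: (Y-X)² = (X+Y)² - 4XY.
  have h2 : ∀ n, (Y n - X n) ^ 2 ≤ (X n + Y n) ^ 2 - 4 * K ^ 2 := fun n => by nlinarith [hXY n]
  have h3 : s ^ 2 - 4 * K ^ 2 = 0 :=
    le_antisymm (by nlinarith) (ge_of_tendsto' h1 fun n => (sq_nonneg _).trans (h2 n))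
  rw [h3] at h1
  have h4 : Tendsto (fun n => (Y n - X n) ^ 2) atTop (𝓝 0) :=
    squeeze_zero (fun n => sq_nonneg _) h2 h1
  have h5 := h4.sqrt
  simp only [Real.sqrt_sq_eq_abs, Real.sqrt_zero] at h5
  exact (tendsto_zero_iff_abs_tendsto_zero _).2 h5

/-- If `X - Y` exceeds a multiple of `X * Y` and has a nonpositive limit, then `X + Y` vanishes. -/
theorem tendsto_add_of_mul_le_sub {X Y : ℕ → ℝ} {K s : ℝ} (hK : 0 < K) (hX : ∀ n, 0 ≤ X n)
    (hY : ∀ n, 0 ≤ Y n) (hXY : ∀ n, K * (X n * Y n) ≤ X n - Y n)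
    (hlim : Tendsto (fun n => X n - Y n) atTop (𝓝 s)) (hs : s ≤ 0) :
    Tendsto (fun n => X n + Y n) atTop (𝓝 0) := by
  have h0 : ∀ n, 0 ≤ X n * Y n := fun n => mul_nonneg (hX n) (hY n)
  have hs0 : s = 0 := le_antisymm hs (ge_of_tendsto' hlim fun n =>
    (mul_nonneg hK.le (h0 n)).trans (hXY n))
  rw [hs0] at hlim
  have h1 : Tendsto (fun n => X n * Y n) atTop (𝓝 0) := by
    refine squeeze_zero h0 (fun n => (le_div_iff₀' hK).2 (hXY n)) ?_
    simpa using hlim.div_const K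
  have h2 : Tendsto (fun n => (X n + Y n) ^ 2) atTop (𝓝 0) := by
    have := (hlim.pow 2).add (h1.const_mul 4)
    simp only [ne_eq, OfNat.ofNat_ne_zero, not_false_eq_true, zero_pow, mul_zero, add_zero] at this
    exact this.congr fun n => by ring
  have h5 := h2.sqrt
  simp only [Real.sqrt_sq_eq_abs, Real.sqrt_zero] at h5
  exact (tendsto_zero_iff_abs_tendsto_zero _).2 h5

variable {S : Type*} [Fintype S]

/-- The AM-GM minimizer on (α+c)(β+c) = c+c² has p(α+c) = (1-p)(β+c) = K. The conditions `h1` and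
`h2`, jointly R > κ, put it at positive α and β, where the curve is approached by protocols. -/
theorem hyperbola_le_optimal {p : ℝ} (hp0 : 0 < p) (hp1 : p < 1) (D : SignalStructure S) {m : ℕ}
    (hm : 3 ≤ m) (hγ : D.gamma ≠ 1) {c K : ℝ} (hc : 0 < c) (hK : 0 ≤ K)
    (hcR : c * (D.gamma ^ (m - 2) - 1) = 1) (hK2 : K ^ 2 = p * (1 - p) * (c + c ^ 2))
    (h1 : p < (1 - p) * D.gamma ^ (m - 2)) (h2 : 1 - p < p * D.gamma ^ (m - 2)) :
    1 - (2 * K - c) ≤ optimalReceiverPayoff p D m := by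
  have hq : 0 < 1 - p := by linarith
  generalize hR : D.gamma ^ (m - 2) = R at *
  have hR' : c * R = 1 + c := by linarith
  have hKp : p * c < K := by
    refine lt_of_pow_lt_pow_left₀ 2 hK ?_
    have : c * p < (1 - p) * (1 + c) := by
      rw [← hR']; nlinarith
    rw [hK2]
    nlinarith [mul_lt_mul_of_pos_left this (mul_pos hp0 hc)]
  have hKq : (1 - p) * c < K := by
    refine lt_of_pow_lt_pow_left₀ 2 hK ?_
    have : c * (1 - p) < p * (1 + c) := by
      rw [← hR']; nlinarith
    rw [hK2]
    nlinarith [mul_lt_mul_of_pos_left this (mul_pos hq hc)]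
  set α := K / p - c with hα
  set β := K / (1 - p) - c with hβ
  have hα0 : 0 < α := sub_pos.2 ((lt_div_iff₀' hp0).2 hKp)
  have hβ0 : 0 < β := sub_pos.2 ((lt_div_iff₀' hq).2 hKq)
  have hprod : (α + c) * (β + c) = c + c ^ 2 := by
    rw [hα, hβ, sub_add_cancel, sub_add_cancel, div_mul_div_comm, ← sq, hK2]
    field_simp
  -- The hyperbola equation rearranges to c(1-α) = β(α+c).
  have hα1 : α < 1 := by
    have : 0 < c * (1 - α) := by
      have : 0 < β * (α + c) := by positivity
      linarith
    linarith [pos_of_mul_pos_right this hc.le]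
  have hβe : (1 - α) / ((1 - α) + R * α) = β := by
    have hRp : 0 < R := pos_of_mul_pos_right (by rw [hR']; linarith) hc.le
    rw [div_eq_iff (by have : 0 < R * α := by positivity
                       linarith)]
    refine mul_left_cancel₀ hc.ne' ?_
    linear_combination (-β * α) * hR' - hprod
  have := curve_le_optimal hp0 hp1 D hm hγ hα0 hα1
  rw [hR, hβe] at this
  have e1 : p * α = K - p * c := by rw [hα]; field_simp
  have e2 : (1 - p) * β = K - (1 - p) * c := by rw [hβ]; field_simp
  linarith

end Limits

end Persuasion

/-! ### The limit of the sender's payoff -/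

open Persuasion in
theorem mainTheorem3 {S : Type*} [Fintype S] (D : Persuasion.SignalStructure S)
    (p : ℝ) (hp0 : 0 < p) (hp1 : p < 1) (m : ℕ) (hm : 2 ≤ m)
    (Q : ℕ → Persuasion.Protocol S m) (hQ : ∀ n, (Q n).IsParsimonious D)
    (σ : ℕ → Persuasion.Strategy m) (hσ : ∀ n, σ n ∈ Persuasion.bestResponses p D (Q n))
    (hopt : Tendsto (fun n => Persuasion.receiverPayoff p D (Q n) (σ n)) atTop
      (𝓝 (Persuasion.optimalReceiverPayoff p D m))) :
    (Persuasion.kappa p < D.gamma ^ (m - 2) →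
      Tendsto (fun n => Persuasion.senderPayoff p D (Q n) (σ n)) atTop
        (𝓝 (p + (2 * p - 1) / (D.gamma ^ (m - 2) - 1)))) ∧
    (D.gamma ^ (m - 2) ≤ Persuasion.kappa p → 1 / 2 < p →
      Tendsto (fun n => Persuasion.senderPayoff p D (Q n) (σ n)) atTop (𝓝 1)) ∧
    (D.gamma ^ (m - 2) ≤ Persuasion.kappa p → p < 1 / 2 →
      Tendsto (fun n => Persuasion.senderPayoff p D (Q n) (σ n)) atTop (𝓝 0)) := by
  have hq : 0 < 1 - p := by linarith
  choose x y hx0 hx1 hy0 hy1 hodds hR hS using fun n => (hQ n).payoffs hp0 hp1 (hσ n)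
  simp only [hR] at hopt
  simp only [hS]
  have h0 := const_le_optimal (by omega : 0 < m) hp0 hp1 D 0
  have h1 := const_le_optimal (by omega : 0 < m) hp0 hp1 D 1
  simp only [Set.Icc.coe_zero, Set.Icc.coe_one, mul_zero, mul_one, sub_self, sub_zero, zero_add,
    add_zero] at h0 h1
  refine ⟨fun hκ => ?_, fun hκ hp => ?_, fun hκ hp => ?_⟩
  · have hk1 : p < (1 - p) * D.gamma ^ (m - 2) := by
      have := (le_max_left _ _).trans_lt hκ
      rwa [div_lt_iff₀' hq] at this
    have hk2 : 1 - p < p * D.gamma ^ (m - 2) := by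
      have := (le_max_right _ _).trans_lt hκ
      rwa [div_lt_iff₀' hp0] at this
    have hR1 : 1 < D.gamma ^ (m - 2) := by nlinarith
    have hγ : D.gamma ≠ 1 := fun e => by rw [e, one_pow] at hR1; exact lt_irrefl _ hR1
    have hm3 : 3 ≤ m := by
      by_contra! hlt
      have : m = 2 := by omega
      subst this
      simp at hR1
    obtain ⟨c, hc⟩ : ∃ c, c = 1 / (D.gamma ^ (m - 2) - 1) := ⟨_, rfl⟩
    have hc0 : 0 < c := by rw [hc]; exact one_div_pos.2 (by linarith)
    have hcR : c * (D.gamma ^ (m - 2) - 1) = 1 := by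
      rw [hc]; exact one_div_mul_cancel (by linarith)
    have hK2 := Real.sq_sqrt (show 0 ≤ p * (1 - p) * (c + c ^ 2) by positivity)
    have hV := hyperbola_le_optimal hp0 hp1 D hm3 hγ hc0 (Real.sqrt_nonneg _) hcR hK2 hk1 hk2
    -- X + Y is 1 + c minus the receiver's payoff, and Y - X is the sender's payoff minus p +
    -- (2p-1)c.
    have key := tendsto_sub_of_hyperbola (X := fun n => p * (1 - x n + c))
      (Y := fun n => (1 - p) * (y n + c)) (K := √(p * (1 - p) * (c + c ^ 2)))
      (s := 1 + c - optimalReceiverPayoff p D m)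
      (fun n => mul_nonneg hp0.le (by linarith [hx1 n]))
      (fun n => mul_nonneg hq.le (by linarith [hy0 n])) (fun n => ?_) ?_ (by linarith)
    · have := key.add_const (p + (2 * p - 1) * c)
      rw [zero_add, hc, mul_one_div] at this
      refine this.congr fun n => ?_
      ring
    · have h : c + c ^ 2 ≤ (1 - x n + c) * (y n + c) := by
        have := mul_le_mul_of_nonneg_left (hodds n) hc0.le
        linear_combination this + (1 - x n) * y n * hcR
      rw [hK2]
      calc p * (1 - p) * (c + c ^ 2) ≤ p * (1 - p) * ((1 - x n + c) * (y n + c)) :=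
            mul_le_mul_of_nonneg_left h (by positivity)
        _ = _ := by ring
    · refine (hopt.const_sub (1 + c)).congr fun n => ?_
      ring
  · have hk : D.gamma ^ (m - 2) * (1 - p) ≤ p := by
      have : kappa p = p / (1 - p) := max_eq_left (by
        rw [div_le_div_iff₀ hp0 hq]; nlinarith)
      rwa [this, le_div_iff₀ hq] at hκ
    -- X - Y is the loss against always playing `H`, and 1 - (X + Y) is the sender's payoff. The
    -- constant K is positive because p > 1/2.
    have key := tendsto_add_of_mul_le_sub (X := fun n => p * (1 - x n))
      (Y := fun n => (1 - p) * (1 - y n)) (K := (2 * p - 1) / (p * (1 - p)))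
      (s := p - optimalReceiverPayoff p D m) (div_pos (by linarith) (by positivity))
      (fun n => mul_nonneg hp0.le (by linarith [hx1 n]))
      (fun n => mul_nonneg hq.le (by linarith [hy1 n])) (fun n => ?_) ?_ (by linarith)
    · have := key.const_sub 1
      rw [sub_zero] at this
      refine this.congr fun n => ?_
      ring
    · have e : (2 * p - 1) / (p * (1 - p)) * (p * (1 - x n) * ((1 - p) * (1 - y n))) =
          (2 * p - 1) * ((1 - x n) * (1 - y n)) := by field_simp
      rw [e]
      have h2 := mul_le_mul_of_nonneg_left (hodds n) hq.le
      have h3 := mul_le_mul_of_nonneg_right hk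
        (mul_nonneg (sub_nonneg.2 (hx1 n)) (hy0 n))
      linarith
    · refine (hopt.const_sub p).congr fun n => ?_
      ring
  · have hk : D.gamma ^ (m - 2) * p ≤ 1 - p := by
      have : kappa p = (1 - p) / p := max_eq_right (by
        rw [div_le_div_iff₀ hq hp0]; nlinarith)
      rwa [this, le_div_iff₀ hp0] at hκ
    -- Mirror image: X - Y is the loss against always playing `L`, and X + Y is the sender's payoff.
    have key := tendsto_add_of_mul_le_sub (X := fun n => (1 - p) * y n)
      (Y := fun n => p * x n) (K := (1 - 2 * p) / (p * (1 - p)))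
      (s := 1 - p - optimalReceiverPayoff p D m) (div_pos (by linarith) (by positivity))
      (fun n => mul_nonneg hq.le (hy0 n))
      (fun n => mul_nonneg hp0.le (hx0 n)) (fun n => ?_) ?_ (by linarith)
    · exact key.congr fun n => by ring
    · have e : (1 - 2 * p) / (p * (1 - p)) * ((1 - p) * y n * (p * x n)) =
          (1 - 2 * p) * (y n * x n) := by field_simp
      rw [e]
      have h2 := mul_le_mul_of_nonneg_left (hodds n) hp0.le
      have h3 := mul_le_mul_of_nonneg_right hk
        (mul_nonneg (sub_nonneg.2 (hx1 n)) (hy0 n))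
      linarith
    · refine (hopt.const_sub (1 - p)).congr fun n => ?_
      ring
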